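/- Let $d \ge 3$ be an integer and let $f:\mathbb{R}^n\to\mathbb{R}$ have derivatives up to order $d$. Let $x^*$ be a local minimizer of $f$ with $\nabla^2 f(x^*)\succ 0$, and suppose that there are $r_L>0$ and $L\ge 0$ such that $$\|\nabla^d f(x)-\nabla^d f(y)\|\le L\|x-y\| \quad\text{whenever } \|x-x^*\|\le r_L,\ \|y-x^*\|\le r_L,$$ where $\|x\|$ is the Euclidean norm on $\mathbb{R}^n$ and $\|D\|=\max_{\|v_1\|,\dots,\|v_d\|\le 1}\langle D, v_1\otimes\cdots\otimes v_d\rangle$ for tensors $D$ of order $d$. Let $T_{a,d}(x)=\sum_{i=0}^d \frac{1}{i!}\langle\nabla^i f(a),(x-a)^{\otimes i}\rangle$ be the Taylor expansion of $f$ of order $d$ at $a$, and let $d'$ be the smallest even integer greater than $d$. A polynomial $p$ in $x\in\mathbb{R}^n$ is called sos-convex if the polynomial $y^T\nabla^2p(x)\,y$ in $(x,y)\in\mathbb{R}^n\times\mathbb{R}^n$ is a sum of squares of polynomials. The $d$-th order Newton method with parameter $\varepsilon>0$ and starting point $x_0$ generates $x_{k+1}$ from $x_k$ as follows. - If $\nabla^2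 f(x_k)\succ0$, let $t(x_k)$ be the optimal value of the program that minimizes $t$ over all $t\ge 0$ for which $T_{x_k,d}(x)+t\|x-x_k\|^{d'}$ is sos-convex; then $x_{k+1}$ is the minimizer over $\mathbb{R}^n$ of $T_{x_k,d}(x)+t(x_k)\|x-x_k\|^{d'}$. - Otherwise, let $\bar t(x_k)$ be the optimal value of the program that minimizes $t$ over all $t\ge 0$ for which $T_{x_k,d}(x)+\frac12\big(\varepsilon-\lambda_{\min}\nabla^2 f(x_k)\big)\|x-x_k\|^2+t\|x-x_k\|^{d'}$ is sos-convex; then $x_{k+1}$ is the minimizer over $\mathbb{R}^n$ of this polynomial with $t=\bar t(x_k)$. Then there are constants $r,c>0$ such that, for every $\varepsilon>0$ and every starting point $x_0$ with $\|x_0-x^*\|\le r$, the method generates exactly one infinite sequence $(x_k)$, and this sequence satisfies $$\|x_{k+1}-x^*\|\le c\,\|x_k-x^*\|^d\qquad\text{for all } k\ge 0,$$ and $x_k\to x^*$. That is, the method converges locally with order $d$. -/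

import Mathlib

namespace SOSNewton

open MvPolynomial

/-- `f` has (Fréchet) derivatives of all orders up to `d` at every point. -/
def HasDerivativesUpTo {n : ℕ} (d : ℕ) (f : EuclideanSpace ℝ (Fin n) → ℝ) : Prop :=
  ∀ m < d, Differentiable ℝ (iteratedFDeriv ℝ m f)

/-- The tensor of partial derivatives of order `i` of `f` at `x`: its entry at `(j 0, …, j (i-1))`
is the derivative of `f` in the coordinate directions `j 0, …, j (i-1)`. -/
noncomputable def partials {n : ℕ} (f : EuclideanSpace ℝ (Fin n) → ℝ)
    (x : EuclideanSpace ℝ (Fin n)) (i : ℕ) (j : Fin i → Fin n) : ℝ :=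
  iteratedFDeriv ℝ i f x (fun l => EuclideanSpace.single (j l) (1 : ℝ))

/-- The Hessian matrix of `f` at `x`. -/
noncomputable def hessian {n : ℕ} (f : EuclideanSpace ℝ (Fin n) → ℝ)
    (x : EuclideanSpace ℝ (Fin n)) : Matrix (Fin n) (Fin n) ℝ :=
  Matrix.of fun i j => partials f x 2 ![i, j]

/-- The smallest eigenvalue of a (nonempty, symmetric) real matrix. -/
noncomputable def minEigenvalue {n : ℕ} (A : Matrix (Fin n) (Fin n) ℝ) : ℝ :=
  sInf (spectrum ℝ A)

/-- The `d`-th order Taylor expansion of `f` at `a`, as a polynomial in `n` variables: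
the sum over `i ≤ d` of `1 / i!` times the tensor inner product of the `i`-th derivative tensor
of `f` at `a` with the `i`-th tensor power of `x - a`. -/
noncomputable def taylorPoly {n : ℕ} (f : EuclideanSpace ℝ (Fin n) → ℝ) (d : ℕ)
    (a : EuclideanSpace ℝ (Fin n)) : MvPolynomial (Fin n) ℝ :=
  ∑ i ∈ Finset.range (d + 1), C (1 / (i.factorial : ℝ)) *
    ∑ j : Fin i → Fin n, C (partials f a i j) * ∏ l : Fin i, (X (j l) - C (a (j l)))

/-- The polynomial `‖x - a‖ ^ 2` in `x`. -/
noncomputable def sqDistPoly {n : ℕ} (a : EuclideanSpace ℝ (Fin n)) : MvPolynomial (Fin n) ℝ :=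
  ∑ i : Fin n, (X i - C (a i)) ^ 2

/-- The smallest even integer greater than `d`. -/
def evenAbove (d : ℕ) : ℕ := 2 * (d / 2 + 1)

theorem isLeast_evenAbove (d : ℕ) : IsLeast {m : ℕ | Even m ∧ d < m} (evenAbove d) := by
  refine ⟨⟨even_two_mul _, ?_⟩, ?_⟩
  · unfold evenAbove; omega
  · rintro m ⟨⟨k, hk⟩, hm⟩
    unfold evenAbove; omega

/-- A polynomial `p` in `x` is sos-convex if the polynomial `yᵀ ∇²p(x) y` in the `2 n` variables
`(x, y)` (left summand: `x`, right summand: `y`) is a sum of squares of polynomials. -/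
def SOSConvex {n : ℕ} (p : MvPolynomial (Fin n) ℝ) : Prop :=
  IsSumSq (∑ i : Fin n, ∑ j : Fin n,
    X (Sum.inr i) * rename Sum.inl (pderiv i (pderiv j p)) * X (Sum.inr j) :
      MvPolynomial (Fin n ⊕ Fin n) ℝ)

/-- `z` is a (global) minimizer of the polynomial `p`. -/
def IsMinimizer {n : ℕ} (p : MvPolynomial (Fin n) ℝ) (z : EuclideanSpace ℝ (Fin n)) : Prop :=
  ∀ y : EuclideanSpace ℝ (Fin n), eval (fun i => z i) p ≤ eval (fun i => y i) p

/-- The polynomial `T_{a,d}(x) + t ‖x - a‖ ^ d'`, with `d'` the smallest even integer above `d`. -/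
noncomputable def surrogate {n : ℕ} (f : EuclideanSpace ℝ (Fin n) → ℝ) (d : ℕ)
    (a : EuclideanSpace ℝ (Fin n)) (t : ℝ) : MvPolynomial (Fin n) ℝ :=
  taylorPoly f d a + C t * sqDistPoly a ^ (evenAbove d / 2)

/-- The polynomial
`T_{a,d}(x) + (1/2) (ε - λ_min (∇²f(a))) ‖x - a‖ ^ 2 + t ‖x - a‖ ^ d'`. -/
noncomputable def surrogateBar {n : ℕ} (f : EuclideanSpace ℝ (Fin n) → ℝ) (d : ℕ) (ε : ℝ)
    (a : EuclideanSpace ℝ (Fin n)) (t : ℝ) : MvPolynomial (Fin n) ℝ :=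
  taylorPoly f d a + C (1 / 2 * (ε - minEigenvalue (hessian f a))) * sqDistPoly a
    + C t * sqDistPoly a ^ (evenAbove d / 2)

/-- `t` is the optimal value of the program that minimizes `s` over all `s ≥ 0` for which the
polynomial `P s` is sos-convex. As no real number is a greatest lower bound of the empty set,
this entails that the program is feasible. -/
def IsOptimalValue {n : ℕ} (P : ℝ → MvPolynomial (Fin n) ℝ) (t : ℝ) : Prop :=
  IsGLB {s : ℝ | 0 ≤ s ∧ SOSConvex (P s)} t

/-- One iteration of the `d`-th order Newton method with parameter `ε` leads from `a` to `z`. -/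
def NewtonStep {n : ℕ} (f : EuclideanSpace ℝ (Fin n) → ℝ) (d : ℕ) (ε : ℝ)
    (a z : EuclideanSpace ℝ (Fin n)) : Prop :=
  ((hessian f a).PosDef ∧
    ∃ t : ℝ, IsOptimalValue (surrogate f d a) t ∧ IsMinimizer (surrogate f d a t) z) ∨
  (¬ (hessian f a).PosDef ∧
    ∃ t : ℝ, IsOptimalValue (surrogateBar f d ε a) t ∧ IsMinimizer (surrogateBar f d ε a t) z)

/-- `x` is a sequence generated by the `d`-th order Newton method with parameter `ε`,
started at `x₀`. -/
def GeneratedFrom {n : ℕ} (f : EuclideanSpace ℝ (Fin n) → ℝ) (d : ℕ) (ε : ℝ)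
    (x₀ : EuclideanSpace ℝ (Fin n)) (x : ℕ → EuclideanSpace ℝ (Fin n)) : Prop :=
  x 0 = x₀ ∧ ∀ k, NewtonStep f d ε (x k) (x (k + 1))

end SOSNewton

/-! Put u = x - a and q = ⌊d/2⌋, so that d' = 2q + 2. For a near x*, the Hessian form of `T_{a,d}`
is yᵀ∇²f(a)y, which exceeds m‖y‖² by a sum of squares, plus terms quadratic in y and of degree 1 to
d - 2 ≤ 2q - 1 in u, with bounded coefficients. Each such term is absorbed, modulo sums of squares,
by a little ‖y‖² and a multiple of ‖u‖^(2q)‖y‖² (`isSumSq_mixed_term`), and the Hessian form of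
‖u‖^d' dominates ‖u‖^(2q)‖y‖². Hence one constant K is feasible for all a near x*, and 0 ≤ t(a) ≤ K
(`eventually_sosLE_hessForm`, `exists_isOptimalValue_surrogate`).

The surrogate is therefore convex everywhere and strongly convex on a fixed ball about x*. Its
gradient at x* is O(δ^d), where δ = ‖a - x*‖: the regularizer contributes O(δ^(d'-1)), and the
Taylor part is handled by comparing the expansions at a and at x*
(`exists_abs_gradForm_taylorPoly_le`). Strong convexity turns the small gradient into a unique
minimizer at distance O(δ^d) (`exists_unique_isMinimizer`). Since d ≥ 3, the step contracts near x*,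
and the iterates never leave the region where the Hessian is positive definite; the branch with ε is
never used. -/

namespace SOSNewton

/-! ### Sum-of-squares inequalities in a commutative ring -/

section SumOfSquares

variable {R : Type*} [CommRing R]

/-- The preorder on a commutative ring whose nonnegative elements are the sums of squares. -/
def SosLE (x y : R) : Prop := IsSumSq (y - x)

theorem SosLE.refl (x : R) : SosLE x x := by
  unfold SosLE; rw [sub_self]; exact .zero

theorem SosLE.trans {x y z : R} (h₁ : SosLE x y) (h₂ : SosLE y z) : SosLE x z := by
  unfold SosLE at *
  have := h₁.add h₂
  rwa [sub_add_sub_cancel'] at this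

theorem SosLE.add {x y z w : R} (h₁ : SosLE x y) (h₂ : SosLE z w) : SosLE (x + z) (y + w) := by
  unfold SosLE at *
  have := h₁.add h₂
  rwa [sub_add_sub_comm] at this

theorem SosLE.mul_left {x y z : R} (hz : IsSumSq z) (h : SosLE x y) : SosLE (z * x) (z * y) := by
  unfold SosLE at *
  have := hz.mul h
  rwa [mul_sub] at this

theorem SosLE.mul_right {x y z : R} (hz : IsSumSq z) (h : SosLE x y) : SosLE (x * z) (y * z) := by
  rw [mul_comm x, mul_comm y]; exact h.mul_left hz

theorem isSumSq_sq (x : R) : IsSumSq (x ^ 2) := by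
  rw [sq]; exact IsSumSq.mul_self x

theorem isSumSq_pow {x : R} (hx : IsSumSq x) (k : ℕ) : IsSumSq (x ^ k) := by
  induction k with
  | zero => rw [pow_zero]; exact IsSumSq.one
  | succ k ih => rw [pow_succ]; exact ih.mul hx

theorem sosLE_sum_sq {ι : Type*} [Fintype ι] [DecidableEq ι] (u : ι → R) (i : ι) :
    SosLE (u i ^ 2) (∑ l, u l ^ 2) := by
  unfold SosLE
  rw [← Finset.add_sum_erase _ _ (Finset.mem_univ i), add_sub_cancel_left]
  exact IsSumSq.sum_sq _ _

/-- The square of a product of `k` variables is dominated by the `k`-th power of the sum of the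
squares of all the variables. -/
theorem sosLE_prod_sq {ι κ : Type*} [Fintype ι] [DecidableEq ι] [DecidableEq κ] (u : ι → R)
    (j : κ → ι) (S : Finset κ) :
    SosLE ((∏ l ∈ S, u (j l)) ^ 2) ((∑ l, u l ^ 2) ^ S.card) := by
  have hs : IsSumSq (∑ l, u l ^ 2) := IsSumSq.sum_sq _ _
  induction S using Finset.induction_on with
  | empty => simpa using SosLE.refl (1 : R)
  | insert b S hb ih =>
    rw [Finset.prod_insert hb, Finset.card_insert_of_notMem hb, mul_pow,
      pow_succ' (∑ l, u l ^ 2)]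
    exact ((sosLE_sum_sq u (j b)).mul_right (isSumSq_sq _)).trans (ih.mul_left hs)

/-- Since 1 + s^q - s^k = (1 - s^k)(1 - s^(q-k)) + s^(q-k), it is enough to treat the product. Both
factors are 1 - s times a geometric sum in s, so the product is (1 - s)² times sums of squares. -/
theorem sosLE_pow_one_add_pow {s : R} (hs : IsSumSq s) {k q : ℕ} (hkq : k ≤ q) :
    SosLE (s ^ k) (1 + s ^ q) := by
  have key : IsSumSq ((1 - s ^ k) * (1 - s ^ (q - k))) := by
    rw [← mul_neg_geom_sum, ← mul_neg_geom_sum, mul_mul_mul_comm]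
    refine (IsSumSq.mul_self _).mul (IsSumSq.mul ?_ ?_) <;>
      exact IsSumSq.sum fun i _ => isSumSq_pow hs i
  unfold SosLE
  have := key.add (isSumSq_pow hs (q - k))
  have e : s ^ q = s ^ k * s ^ (q - k) := by rw [← pow_add, Nat.add_sub_cancel' hkq]
  have e' : 1 + s ^ q - s ^ k = (1 - s ^ k) * (1 - s ^ (q - k)) + s ^ (q - k) := by
    rw [e]; ring
  rwa [e']

variable [Algebra ℝ R]

theorem isSumSq_smul {c : ℝ} (hc : 0 ≤ c) {x : R} (hx : IsSumSq x) : IsSumSq (c • x) := by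
  have : c • x = (algebraMap ℝ R (√c)) ^ 2 * x := by
    rw [← map_pow, Real.sq_sqrt hc, Algebra.smul_def]
  rw [this]
  exact (isSumSq_sq _).mul hx

theorem SosLE.smul {c : ℝ} (hc : 0 ≤ c) {x y : R} (h : SosLE x y) : SosLE (c • x) (c • y) := by
  unfold SosLE at *
  rw [← smul_sub]
  exact isSumSq_smul hc h

theorem sosLE_smul_of_le {c₁ c₂ : ℝ} (hc : c₁ ≤ c₂) {x : R} (hx : IsSumSq x) :
    SosLE (c₁ • x) (c₂ • x) := by
  unfold SosLE
  rw [← sub_smul]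
  exact isSumSq_smul (sub_nonneg.2 hc) hx

/-- Intermediate powers of a sum of squares are dominated by a small constant and a multiple of
the top power. -/
theorem sosLE_pow_small_add_pow {s : R} (hs : IsSumSq s) {k q : ℕ} (hk : 1 ≤ k) (hkq : k ≤ q)
    {c : ℝ} (hc : 1 ≤ c) : SosLE (s ^ k) (c⁻¹ • (1 : R) + c ^ q • s ^ q) := by
  have hc0 : 0 < c := by linarith
  -- The previous bound is applied to c s and divided by c^k; k ≥ 1 is what makes the constant term
  -- as small as c⁻¹.
  have h := (sosLE_pow_one_add_pow (isSumSq_smul hc0.le hs) hkq).smul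
    (inv_nonneg.2 (pow_nonneg hc0.le k))
  rw [smul_pow, smul_pow, smul_smul, inv_mul_cancel₀ (pow_pos hc0 k).ne', one_smul, smul_add,
    smul_smul] at h
  refine h.trans (SosLE.add (sosLE_smul_of_le ?_ IsSumSq.one)
    (sosLE_smul_of_le ?_ (isSumSq_pow hs q)))
  · exact inv_anti₀ hc0 (le_self_pow₀ hc (by omega))
  · exact mul_le_of_le_one_left (pow_nonneg hc0.le q) (inv_le_one_of_one_le₀ (one_le_pow₀ hc))

/-- A mixed term of degree between `1` and `2 q - 1` in `u` and degree `2` in `y` is absorbed by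
a small multiple of `‖y‖ ^ 2` and a multiple of `‖u‖ ^ (2 q) ‖y‖ ^ 2`. -/
theorem isSumSq_mixed_term {ι κ : Type*} [Fintype ι] [DecidableEq ι] [DecidableEq κ]
    (u y : ι → R) (j : κ → ι) (S : Finset κ) {q : ℕ} (hS : 1 ≤ S.card) (hSq : S.card + 1 ≤ 2 * q)
    (i i' : ι) {η M c K : ℝ} (hη : 0 < η) (hc : |c| ≤ M)
    (hK : η / 2 + M ^ 2 / (2 * η) * (1 + M ^ 2 / η ^ 2) ^ q ≤ K) :
    IsSumSq (η • (∑ l, y l ^ 2) + K • ((∑ l, u l ^ 2) ^ q * ∑ l, y l ^ 2) +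
      c • (y i * y i' * ∏ l ∈ S, u (j l))) := by
  set s := ∑ l, u l ^ 2
  set Y := ∑ l, y l ^ 2
  have hs : IsSumSq s := IsSumSq.sum_sq _ _
  have hY : IsSumSq Y := IsSumSq.sum_sq _ _
  -- The monomial is split into p r with u-degrees ⌊|S|/2⌋ and ⌈|S|/2⌉, both at most q. Only the
  -- second is certainly positive, so only r² can be given a small constant term.
  obtain ⟨B, hBS, hB⟩ := Finset.exists_subset_card_eq (s := S) (n := S.card / 2) (by omega)
  have hB' : (S \ B).card = S.card - S.card / 2 := by rw [Finset.card_sdiff_of_subset hBS, hB]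
  set p := (∏ l ∈ B, u (j l)) * y i with hp
  set r := (∏ l ∈ S \ B, u (j l)) * y i' with hr
  have hprod : y i * y i' * ∏ l ∈ S, u (j l) = p * r := by
    rw [← Finset.prod_sdiff hBS]; ring
  have hpY : SosLE (p ^ 2) ((1 + s ^ q) * Y) := by
    rw [hp, mul_pow]
    exact ((sosLE_prod_sq u j B).mul_right (isSumSq_sq _)).trans
      (((sosLE_sum_sq y i).mul_left (isSumSq_pow hs _)).trans
        ((sosLE_pow_one_add_pow hs (by omega)).mul_right hY))
  -- Chosen so that M²/(2η) · a⁻¹ ≤ η/2: p² and r² then each cost at most (η/2)‖y‖².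
  set a : ℝ := 1 + M ^ 2 / η ^ 2 with ha
  have ha1 : 1 ≤ a := le_add_of_nonneg_right (by positivity)
  have hrY : SosLE (r ^ 2) ((a⁻¹ • (1 : R) + a ^ q • s ^ q) * Y) := by
    rw [hr, mul_pow]
    exact ((sosLE_prod_sq u j _).mul_right (isSumSq_sq _)).trans
      (((sosLE_sum_sq y i').mul_left (isSumSq_pow hs _)).trans
        ((sosLE_pow_small_add_pow hs (by omega) (by omega) ha1).mul_right hY))
  have hM : c ^ 2 ≤ M ^ 2 := sq_le_sq' (by linarith [neg_abs_le c]) ((le_abs_self c).trans hc)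
  have hsq : IsSumSq ((η / 2) • p ^ 2 + (M ^ 2 / (2 * η)) • r ^ 2 + c • (p * r)) := by
    have e : (η / 2) • p ^ 2 + (M ^ 2 / (2 * η)) • r ^ 2 + c • (p * r)
        = (η / 2) • (p + (c / η) • r) ^ 2 + ((M ^ 2 - c ^ 2) / (2 * η)) • r ^ 2 := by
      have e1 : M ^ 2 / (2 * η) = (η / 2) * (c / η) ^ 2 + (M ^ 2 - c ^ 2) / (2 * η) := by
        field_simp; ring
      have e2 : c • (p * r) = ((η / 2) * (2 * (c / η))) • (p * r) := by
        congr 1; field_simp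
      rw [e1, e2]
      simp only [Algebra.smul_def, map_add, map_mul, map_pow, map_ofNat]
      ring
    rw [e]
    exact (isSumSq_smul (by positivity) (isSumSq_sq _)).add
      (isSumSq_smul (div_nonneg (by linarith) (by positivity)) (isSumSq_sq _))
  have h1 := hpY.smul (show 0 ≤ η / 2 by positivity)
  have h2 := hrY.smul (show 0 ≤ M ^ 2 / (2 * η) by positivity)
  have h12 := (h1.add h2).add (SosLE.refl (c • (p * r)))
  have h3 : IsSumSq ((η / 2) • ((1 + s ^ q) * Y) +
      (M ^ 2 / (2 * η)) • ((a⁻¹ • (1 : R) + a ^ q • s ^ q) * Y) + c • (p * r)) := by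
    have := hsq.add h12
    rwa [add_sub_cancel] at this
  have hη2 : η / 2 + M ^ 2 / (2 * η) * a⁻¹ ≤ η := by
    have : M ^ 2 / (2 * η) * a⁻¹ ≤ η / 2 := by
      rw [← div_eq_mul_inv, div_le_iff₀ (by linarith), ha]
      have : η / 2 * (1 + M ^ 2 / η ^ 2) = η / 2 + M ^ 2 / (2 * η) := by field_simp
      rw [this]; linarith
    linarith
  have h4 := ((sosLE_smul_of_le hη2 hY).add
    (sosLE_smul_of_le hK ((isSumSq_pow hs q).mul hY))).add (SosLE.refl (c • (p * r)))
  rw [hprod]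
  have h5 := h3.add h4
  have e : (η / 2) • ((1 + s ^ q) * Y) +
      (M ^ 2 / (2 * η)) • ((a⁻¹ • (1 : R) + a ^ q • s ^ q) * Y) =
      (η / 2 + M ^ 2 / (2 * η) * a⁻¹) • Y +
        (η / 2 + M ^ 2 / (2 * η) * a ^ q) • (s ^ q * Y) := by
    simp only [Algebra.smul_def, map_add, map_mul]
    ring
  rwa [e, add_sub_cancel] at h5

end SumOfSquares

open MvPolynomial

/-! ### The Hessian form as a second directional derivative -/

section HessianForm

variable {n : ℕ}

/-- The derivation of `ℝ[x, y]` that differentiates in `x` in the direction `y`. -/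
noncomputable def dirDeriv (n : ℕ) : Derivation ℝ (MvPolynomial (Fin n ⊕ Fin n) ℝ)
    (MvPolynomial (Fin n ⊕ Fin n) ℝ) :=
  mkDerivation ℝ (Sum.elim (fun i => X (Sum.inr i)) 0)

/-- The polynomial `yᵀ ∇²p(x) y`. -/
noncomputable def hessForm (p : MvPolynomial (Fin n) ℝ) : MvPolynomial (Fin n ⊕ Fin n) ℝ :=
  dirDeriv n (dirDeriv n (rename Sum.inl p))

@[simp] theorem dirDeriv_X_inl (i : Fin n) : dirDeriv n (X (Sum.inl i)) = X (Sum.inr i) := by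
  simp [dirDeriv, mkDerivation_X]

@[simp] theorem dirDeriv_X_inr (i : Fin n) : dirDeriv n (X (Sum.inr i)) = 0 := by
  simp [dirDeriv, mkDerivation_X]

@[simp] theorem dirDeriv_C (c : ℝ) : dirDeriv n (C c) = 0 :=
  (dirDeriv n).map_algebraMap c

theorem dirDeriv_rename (p : MvPolynomial (Fin n) ℝ) :
    dirDeriv n (rename Sum.inl p) = ∑ i, X (Sum.inr i) * rename Sum.inl (pderiv i p) := by
  induction p using MvPolynomial.induction_on with
  | C c => simp
  | add p q hp hq => simp [hp, hq, mul_add, Finset.sum_add_distrib]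
  | mul_X p i hp =>
    simp only [map_mul, rename_X, Derivation.leibniz, hp, dirDeriv_X_inl, smul_eq_mul, pderiv_X,
      map_add, mul_add, Finset.sum_add_distrib, Finset.mul_sum]
    congr 1
    · rw [Finset.sum_eq_single i]
      · simp [mul_comm]
      · intro b _ hb; simp [Pi.single_eq_of_ne hb.symm]
      · simp
    · exact Finset.sum_congr rfl fun _ _ => by ring

/-- `dirDeriv` treats y as constant, so applying it twice creates no terms beyond yᵀ∇²p(x)y. Hessian
forms of products and powers can then be computed by the Leibniz rule alone. -/
theorem sosConvex_iff (p : MvPolynomial (Fin n) ℝ) : SOSConvex p ↔ IsSumSq (hessForm p) := by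
  unfold SOSConvex hessForm
  rw [dirDeriv_rename, map_sum]
  simp only [Derivation.leibniz, dirDeriv_X_inr, smul_eq_mul, mul_zero, add_zero, dirDeriv_rename,
    Finset.mul_sum]
  rw [Finset.sum_comm]
  exact iff_of_eq (congrArg _ (Finset.sum_congr rfl fun i _ => Finset.sum_congr rfl fun j _ => by
    ring))

theorem hessForm_add (p p' : MvPolynomial (Fin n) ℝ) :
    hessForm (p + p') = hessForm p + hessForm p' := by
  simp [hessForm]

theorem hessForm_C_mul (c : ℝ) (p : MvPolynomial (Fin n) ℝ) :
    hessForm (C c * p) = c • hessForm p := by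
  simp [hessForm, C_mul']

theorem hessForm_sum {ι : Type*} (S : Finset ι) (p : ι → MvPolynomial (Fin n) ℝ) :
    hessForm (∑ i ∈ S, p i) = ∑ i ∈ S, hessForm (p i) := by
  simp [hessForm]

theorem derivation_prod {R A ι : Type*} [CommSemiring R] [CommSemiring A] [Algebra R A]
    [DecidableEq ι] (D : Derivation R A A) (S : Finset ι) (g : ι → A) :
    D (∏ l ∈ S, g l) = ∑ l ∈ S, D (g l) * ∏ l' ∈ S.erase l, g l' := by
  induction S using Finset.induction_on with
  | empty => simp
  | insert b S hb ih =>
    rw [Finset.prod_insert hb, Finset.sum_insert hb, Finset.erase_insert hb, D.leibniz, ih,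
      smul_eq_mul, smul_eq_mul, Finset.mul_sum, add_comm, mul_comm]
    congr 1
    refine Finset.sum_congr rfl fun l hl => ?_
    have hlb : b ≠ l := fun h => hb (h ▸ hl)
    rw [Finset.erase_insert_of_ne hlb, Finset.prod_insert (by simp [hb])]
    ring

/-- The polynomial `x i - a i` in `ℝ[x, y]`. -/
noncomputable def shiftVar (a : EuclideanSpace ℝ (Fin n)) (i : Fin n) :
    MvPolynomial (Fin n ⊕ Fin n) ℝ := X (Sum.inl i) - C (a i)

/-- The polynomial `‖x - a‖ ^ 2` in `ℝ[x, y]`. -/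
noncomputable def shiftSq (a : EuclideanSpace ℝ (Fin n)) : MvPolynomial (Fin n ⊕ Fin n) ℝ :=
  ∑ i, shiftVar a i ^ 2

/-- The polynomial `‖y‖ ^ 2` in `ℝ[x, y]`. -/
noncomputable def dirSq (n : ℕ) : MvPolynomial (Fin n ⊕ Fin n) ℝ :=
  ∑ i : Fin n, X (Sum.inr i) ^ 2

@[simp] theorem dirDeriv_shiftVar (a : EuclideanSpace ℝ (Fin n)) (i : Fin n) :
    dirDeriv n (shiftVar a i) = X (Sum.inr i) := by
  simp [shiftVar, Derivation.map_sub]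

theorem hessForm_prod (a : EuclideanSpace ℝ (Fin n)) {i : ℕ} (j : Fin i → Fin n) :
    hessForm (∏ l : Fin i, (X (j l) - C (a (j l)))) =
      ∑ l : Fin i, ∑ l' ∈ Finset.univ.erase l, X (Sum.inr (j l)) * X (Sum.inr (j l')) *
        ∏ l'' ∈ (Finset.univ.erase l).erase l', shiftVar a (j l'') := by
  have h : rename Sum.inl (∏ l : Fin i, (X (j l) - C (a (j l)) : MvPolynomial (Fin n) ℝ)) =
      ∏ l : Fin i, shiftVar a (j l) := by
    simp [shiftVar]
  rw [hessForm, h, derivation_prod, map_sum]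
  refine Finset.sum_congr rfl fun l _ => ?_
  rw [Derivation.leibniz, dirDeriv_shiftVar, dirDeriv_X_inr, smul_zero, add_zero, derivation_prod,
    smul_eq_mul, Finset.mul_sum]
  refine Finset.sum_congr rfl fun l' _ => ?_
  rw [dirDeriv_shiftVar, mul_assoc]

theorem hessForm_taylorPoly (f : EuclideanSpace ℝ (Fin n) → ℝ) (d : ℕ)
    (a : EuclideanSpace ℝ (Fin n)) :
    hessForm (taylorPoly f d a) = ∑ i ∈ Finset.range (d + 1), ∑ j : Fin i → Fin n,
      (1 / (i.factorial : ℝ) * partials f a i j) •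
        hessForm (∏ l : Fin i, (X (j l) - C (a (j l)))) := by
  simp only [taylorPoly, hessForm_sum, hessForm_C_mul, Finset.smul_sum, smul_smul]

theorem rename_sqDistPoly (a : EuclideanSpace ℝ (Fin n)) :
    rename Sum.inl (sqDistPoly a) = shiftSq a := by
  simp [sqDistPoly, shiftSq, shiftVar]

theorem dirDeriv_shiftSq (a : EuclideanSpace ℝ (Fin n)) :
    dirDeriv n (shiftSq a) = 2 * ∑ i, shiftVar a i * X (Sum.inr i) := by
  simp only [shiftSq, map_sum, Derivation.leibniz_pow, dirDeriv_shiftVar, Finset.mul_sum]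
  refine Finset.sum_congr rfl fun i _ => ?_
  simp

/-- The Leibniz rule applied twice. For q = 0 the truncated exponent q - 1 is harmless because its
term carries the factor q. -/
theorem hessForm_sqDistPoly_pow (a : EuclideanSpace ℝ (Fin n)) (q : ℕ) :
    hessForm (sqDistPoly a ^ (q + 1)) =
      ((q + 1 : ℕ) : ℝ) • ((2 : ℝ) • (shiftSq a ^ q * dirSq n) +
        (q : ℝ) • (shiftSq a ^ (q - 1) * (2 * ∑ i, shiftVar a i * X (Sum.inr i)) ^ 2)) := by
  have h2 : dirDeriv n (2 * ∑ i, shiftVar a i * X (Sum.inr i)) = 2 * dirSq n := by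
    have : (2 : MvPolynomial (Fin n ⊕ Fin n) ℝ) = C 2 := (map_ofNat C 2).symm
    rw [this, Derivation.leibniz, dirDeriv_C, smul_zero, add_zero, map_sum, dirSq, smul_eq_mul]
    congr 1
    refine Finset.sum_congr rfl fun i _ => ?_
    rw [Derivation.leibniz, dirDeriv_X_inr, dirDeriv_shiftVar, smul_zero, zero_add, smul_eq_mul, sq]
  rw [hessForm, map_pow, rename_sqDistPoly, Derivation.leibniz_pow, dirDeriv_shiftSq, map_nsmul,
    smul_eq_mul, Derivation.leibniz, Derivation.leibniz_pow, dirDeriv_shiftSq, h2,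
    Nat.add_sub_cancel]
  simp only [smul_eq_mul, nsmul_eq_mul]
  simp only [Algebra.smul_def, map_natCast, map_ofNat]
  ring

/-- With A = BᵀB the form is the sum of the squares of the entries of By. -/
theorem isSumSq_of_posSemidef {R : Type*} [CommRing R] [Algebra ℝ R]
    {A : Matrix (Fin n) (Fin n) ℝ} (hA : A.PosSemidef) (y : Fin n → R) :
    IsSumSq (∑ i, ∑ j, A i j • (y i * y j)) := by
  obtain ⟨B, rfl⟩ : ∃ B : Matrix (Fin n) (Fin n) ℝ, A = B.conjTranspose * B := by
    open scoped MatrixOrder ComplexOrder in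
    obtain ⟨B, hB⟩ := CStarAlgebra.nonneg_iff_eq_star_mul_self.mp hA.nonneg
    exact ⟨B, hB⟩
  have : ∑ i, ∑ j, (B.conjTranspose * B) i j • (y i * y j) = ∑ k, (∑ i, B k i • y i) ^ 2 := by
    simp only [Matrix.mul_apply, Matrix.conjTranspose_apply, star_trivial, sq, Finset.sum_mul_sum,
      Finset.sum_smul, smul_mul_smul_comm]
    conv_rhs => rw [Finset.sum_comm]
    exact Finset.sum_congr rfl fun i _ => Finset.sum_comm
  rw [this]
  exact IsSumSq.sum_sq _ _

/-- The weights let the lemma be nested: the total weight of an inner sum serves as one weight of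
the outer sum. -/
theorem isSumSq_absorb_sum {ι R : Type*} [CommRing R] [Algebra ℝ R] {S : Finset ι} {Y Z : R}
    {η K : ℝ} {w : ι → ℝ} {g : ι → R}
    (h : ∀ i ∈ S, IsSumSq ((w i * η) • Y + (w i * K) • Z + g i)) :
    IsSumSq (((∑ i ∈ S, w i) * η) • Y + ((∑ i ∈ S, w i) * K) • Z + ∑ i ∈ S, g i) := by
  have := IsSumSq.sum h
  simpa only [Finset.sum_add_distrib, ← Finset.sum_smul, ← Finset.sum_mul] using this

/-- The terms of degree at least `3` of a Taylor expansion with bounded coefficients contribute to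
the Hessian form a part that is absorbed by a small multiple of `‖y‖ ^ 2` and a multiple of
`‖x - a‖ ^ (2 q) ‖y‖ ^ 2`, uniformly in the coefficients and the centre. -/
theorem exists_absorb_hessForm_tail (n d : ℕ) {q : ℕ} (hq : d ≤ 2 * q + 1) {η : ℝ} (hη : 0 < η)
    (M : ℝ) : ∃ K : ℝ, 0 ≤ K ∧ ∀ (a : EuclideanSpace ℝ (Fin n))
      (co : (i : ℕ) → (Fin i → Fin n) → ℝ), (∀ i ≤ d, ∀ j, |co i j| ≤ M) →
      IsSumSq (η • dirSq n + K • (shiftSq a ^ q * dirSq n) +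
        ∑ i ∈ Finset.Ico 3 (d + 1), ∑ j : Fin i → Fin n,
          co i j • hessForm (∏ l : Fin i, (X (j l) - C (a (j l))))) := by
  -- N counts the mixed terms: index tuples together with an ordered pair of distinct differentiated
  -- factors. Each term receives the share η/(N + 1).
  obtain ⟨N, hN⟩ : ∃ N : ℝ, N = ∑ i ∈ Finset.Ico 3 (d + 1), ∑ _j : Fin i → Fin n, ∑ l : Fin i,
    ∑ _l' ∈ Finset.univ.erase l, (1 : ℝ) := ⟨_, rfl⟩
  have hN0 : 0 ≤ N := by
    rw [hN]
    refine Finset.sum_nonneg fun _ _ => Finset.sum_nonneg fun _ _ => Finset.sum_nonneg fun _ _ =>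
      Finset.sum_nonneg fun _ _ => zero_le_one
  obtain ⟨η', hη'⟩ : ∃ η', η' = η / (N + 1) := ⟨_, rfl⟩
  have hη'0 : 0 < η' := by rw [hη']; positivity
  obtain ⟨K', hK'⟩ : ∃ K', K' = η' / 2 + M ^ 2 / (2 * η') * (1 + M ^ 2 / η' ^ 2) ^ q := ⟨_, rfl⟩
  refine ⟨N * K', mul_nonneg hN0 (by rw [hK']; positivity), fun a co hco => ?_⟩
  have key : IsSumSq ((N * η') • dirSq n + (N * K') • (shiftSq a ^ q * dirSq n) +
        ∑ i ∈ Finset.Ico 3 (d + 1), ∑ j : Fin i → Fin n,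
          co i j • hessForm (∏ l : Fin i, (X (j l) - C (a (j l))))) := by
    rw [hN]
    refine isSumSq_absorb_sum fun i hi => isSumSq_absorb_sum fun j _ => ?_
    rw [hessForm_prod, Finset.smul_sum]
    refine isSumSq_absorb_sum fun l _ => ?_
    rw [Finset.smul_sum]
    refine isSumSq_absorb_sum fun l' hl' => ?_
    rw [one_mul, one_mul]
    have hi' := Finset.mem_Ico.1 hi
    have hcard : ((Finset.univ.erase l).erase l').card = i - 2 := by
      rw [Finset.card_erase_of_mem hl', Finset.card_erase_of_mem (Finset.mem_univ l),
        Finset.card_univ, Fintype.card_fin, Nat.sub_sub]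
    exact isSumSq_mixed_term (shiftVar a) (fun i => X (Sum.inr i)) j _ (by omega) (by omega) _ _
      hη'0 (hco i (by omega) j) hK'.ge
  have hle : N * η' ≤ η := by
    rw [hη', mul_div_assoc', div_le_iff₀ (by positivity)]
    nlinarith
  have hY : IsSumSq (dirSq n) := IsSumSq.sum_sq _ _
  have := key.add (sosLE_smul_of_le hle hY)
  rw [add_right_comm _ _ (η • dirSq n - _), add_right_comm _ _ (η • dirSq n - _),
    add_sub_cancel] at this
  exact this

end HessianForm

/-! ### Restriction to lines, convexity and minimizers -/

section Lines

variable {n : ℕ}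

/-- The restriction of polynomials in `(x, y)` to the line `s ↦ (x + s v, v)`. -/
noncomputable def onLine (x v : EuclideanSpace ℝ (Fin n)) :
    MvPolynomial (Fin n ⊕ Fin n) ℝ →ₐ[ℝ] Polynomial ℝ :=
  aeval (Sum.elim (fun i => Polynomial.C (x i) + Polynomial.X * Polynomial.C (v i))
    (fun i => Polynomial.C (v i)))

/-- The chain rule along x + s v. It reduces gradient and Hessian bounds on p to statements about
polynomials in one variable. -/
theorem derivative_onLine (x v : EuclideanSpace ℝ (Fin n)) (P : MvPolynomial (Fin n ⊕ Fin n) ℝ) :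
    (onLine x v P).derivative = onLine x v (dirDeriv n P) := by
  induction P using MvPolynomial.induction_on with
  | C c => simp [onLine]
  | add p q hp hq => simp [hp, hq]
  | mul_X p i hp =>
    rw [map_mul, Polynomial.derivative_mul, hp, Derivation.leibniz, map_add, smul_eq_mul,
      smul_eq_mul, map_mul, map_mul]
    rcases i with i | i
    · rw [dirDeriv_X_inl]
      simp [onLine]
      ring
    · rw [dirDeriv_X_inr]
      simp [onLine]
      ring

theorem eval_onLine (x v : EuclideanSpace ℝ (Fin n)) (P : MvPolynomial (Fin n ⊕ Fin n) ℝ) (s : ℝ) :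
    (onLine x v P).eval s = eval (Sum.elim (x + s • v) v) P := by
  induction P using MvPolynomial.induction_on with
  | C c => simp [onLine]
  | add p q hp hq => simp [hp, hq]
  | mul_X p i hp =>
    rw [map_mul, Polynomial.eval_mul, hp, map_mul]
    rcases i with i | i
    · simp [onLine]
      ring_nf
      simp
    · simp [onLine]

theorem eval_onLine_rename (x v : EuclideanSpace ℝ (Fin n)) (p : MvPolynomial (Fin n) ℝ) (s : ℝ) :
    (onLine x v (rename Sum.inl p)).eval s = eval (x + s • v) p := by
  rw [eval_onLine, eval_rename]
  rfl

/-- The derivative of `p` at `x` in the direction `v`. -/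
noncomputable def gradForm (p : MvPolynomial (Fin n) ℝ) (x v : EuclideanSpace ℝ (Fin n)) : ℝ :=
  eval (Sum.elim x v) (dirDeriv n (rename Sum.inl p))

theorem gradForm_eq_sum (p : MvPolynomial (Fin n) ℝ) (x v : EuclideanSpace ℝ (Fin n)) :
    gradForm p x v = ∑ i, v i * eval x (pderiv i p) := by
  rw [gradForm, dirDeriv_rename]
  simp only [map_sum, map_mul, eval_X, eval_rename, Sum.elim_inr]
  rfl

theorem gradForm_smul (p : MvPolynomial (Fin n) ℝ) (x v : EuclideanSpace ℝ (Fin n)) (c : ℝ) :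
    gradForm p x (c • v) = c * gradForm p x v := by
  simp only [gradForm_eq_sum, Finset.mul_sum, PiLp.smul_apply, smul_eq_mul, mul_assoc]

theorem gradForm_add (p p' : MvPolynomial (Fin n) ℝ) (x v : EuclideanSpace ℝ (Fin n)) :
    gradForm (p + p') x v = gradForm p x v + gradForm p' x v := by
  simp [gradForm]

theorem derivative_onLine_eval_zero (x v : EuclideanSpace ℝ (Fin n)) (p : MvPolynomial (Fin n) ℝ) :
    (onLine x v (rename Sum.inl p)).derivative.eval 0 = gradForm p x v := by
  rw [derivative_onLine, eval_onLine, zero_smul, add_zero, gradForm]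

theorem eval_zero_le_eval_of_derivative_nonneg {P : Polynomial ℝ}
    (h : ∀ s ∈ Set.Icc (0 : ℝ) 1, 0 ≤ P.derivative.eval s) {s : ℝ} (hs : s ∈ Set.Icc (0 : ℝ) 1) :
    P.eval 0 ≤ P.eval s := by
  have hm : MonotoneOn (fun s => P.eval s) (Set.Icc (0 : ℝ) 1) := by
    refine monotoneOn_of_deriv_nonneg (convex_Icc 0 1) P.continuous.continuousOn
      P.differentiable.differentiableOn fun s hs => ?_
    rw [Polynomial.deriv]
    exact h s (interior_subset hs)
  exact hm (by simp) hs hs.1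

theorem add_le_eval_one_of_le_derivative_derivative {P : Polynomial ℝ} {κ : ℝ}
    (h : ∀ s ∈ Set.Icc (0 : ℝ) 1, κ ≤ P.derivative.derivative.eval s) :
    P.eval 0 + P.derivative.eval 0 + κ / 2 ≤ P.eval 1 := by
  have h1 : ∀ s ∈ Set.Icc (0 : ℝ) 1, P.derivative.eval 0 + κ * s ≤ P.derivative.eval s := by
    intro s hs
    have := eval_zero_le_eval_of_derivative_nonneg
      (P := P.derivative - Polynomial.C κ * Polynomial.X) (fun s hs => by simpa using h s hs) hs
    simp at this
    linarith
  have := eval_zero_le_eval_of_derivative_nonneg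
    (P := P - Polynomial.C (P.derivative.eval 0) * Polynomial.X -
      Polynomial.C (κ / 2) * Polynomial.X ^ 2)
    (fun s hs => by
      have := h1 s hs
      simp
      linarith) (s := 1) (by simp)
  simp at this
  linarith

theorem eval_add_ge_of_le_hessForm {p : MvPolynomial (Fin n) ℝ} {x v : EuclideanSpace ℝ (Fin n)}
    {κ : ℝ} (h : ∀ s ∈ Set.Icc (0 : ℝ) 1, κ ≤ eval (Sum.elim (x + s • v) v) (hessForm p)) :
    eval x p + gradForm p x v + κ / 2 ≤ eval (x + v) p := by
  have := add_le_eval_one_of_le_derivative_derivative (P := onLine x v (rename Sum.inl p)) (κ := κ)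
    (fun s hs => by rw [derivative_onLine, derivative_onLine, eval_onLine]; exact h s hs)
  rw [derivative_onLine_eval_zero, eval_onLine_rename, eval_onLine_rename] at this
  simpa using this

theorem eval_ge_of_le_hessForm {p : MvPolynomial (Fin n) ℝ} {x y : EuclideanSpace ℝ (Fin n)}
    {κ : ℝ} (h : ∀ w ∈ segment ℝ x y, κ ≤ eval (Sum.elim w (y - x)) (hessForm p)) :
    eval x p + gradForm p x (y - x) + κ / 2 ≤ eval y p := by
  have := eval_add_ge_of_le_hessForm (p := p) (x := x) (v := y - x) (κ := κ) fun s hs =>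
    h _ (by rw [segment_eq_image']; exact ⟨s, hs, rfl⟩)
  have e : (x + (y - x) : EuclideanSpace ℝ (Fin n)) = y := by abel
  rwa [e] at this

theorem continuous_eval_euclidean (p : MvPolynomial (Fin n) ℝ) :
    Continuous fun x : EuclideanSpace ℝ (Fin n) => eval x p :=
  (MvPolynomial.continuous_eval p).comp (PiLp.continuous_ofLp 2 _)

/-- A convex polynomial that is strongly convex on a ball, with a small enough gradient at its
centre, has exactly one minimizer; it is close to the centre. -/
theorem exists_unique_isMinimizer {p : MvPolynomial (Fin n) ℝ} {b : EuclideanSpace ℝ (Fin n)}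
    {ρ μ ζ : ℝ} (hρ : 0 < ρ) (hμ : 0 < μ) (hζ0 : 0 ≤ ζ)
    (hpsd : ∀ x v : EuclideanSpace ℝ (Fin n), 0 ≤ eval (Sum.elim x v) (hessForm p))
    (hpd : ∀ x ∈ Metric.closedBall b ρ, ∀ v : EuclideanSpace ℝ (Fin n),
      μ * ‖v‖ ^ 2 ≤ eval (Sum.elim x v) (hessForm p))
    (hg : ∀ v, |gradForm p b v| ≤ ζ * ‖v‖) (hζ : 2 * ζ < μ * ρ) :
    ∃ z, IsMinimizer p z ∧ (∀ z', IsMinimizer p z' → z' = z) ∧ μ * ‖z - b‖ ≤ 2 * ζ := by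
  have hstrong : ∀ x ∈ Metric.closedBall b ρ, ∀ y ∈ Metric.closedBall b ρ,
      eval x p + gradForm p x (y - x) + μ * ‖y - x‖ ^ 2 / 2 ≤ eval y p := fun x hx y hy =>
    eval_ge_of_le_hessForm fun w hw =>
      hpd w ((convex_closedBall b ρ).segment_subset hx hy hw) _
  have hb : b ∈ Metric.closedBall b ρ := Metric.mem_closedBall_self hρ.le
  have hfromb : ∀ y ∈ Metric.closedBall b ρ,
      eval b p - ζ * ‖y - b‖ + μ * ‖y - b‖ ^ 2 / 2 ≤ eval y p := fun y hy => by
    have h1 := hstrong b hb y hy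
    have h2 := (abs_le.1 (hg (y - b))).1
    linarith
  -- The segment from b to y crosses the sphere at w, where p already exceeds p(b) because 2ζ < μρ.
  -- Convexity then forces a positive slope at w, so p(y) exceeds p(w).
  have hout : ∀ y ∉ Metric.closedBall b ρ, eval b p < eval y p := by
    intro y hy
    rw [Metric.mem_closedBall, dist_eq_norm, not_le] at hy
    have hD : 0 < ‖y - b‖ := hρ.trans hy
    set θ := ρ / ‖y - b‖ with hθ
    have hθ0 : 0 < θ := by positivity
    have hθ1 : θ < 1 := (div_lt_one hD).2 hy
    set w := b + θ • (y - b) with hw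
    have hwb : ‖w - b‖ = ρ := by
      rw [hw, add_sub_cancel_left, norm_smul, Real.norm_of_nonneg hθ0.le, hθ,
        div_mul_cancel₀ _ hD.ne']
    have h1 : eval b p < eval w p := by
      have := hfromb w (by rw [Metric.mem_closedBall, dist_eq_norm, hwb])
      rw [hwb] at this
      nlinarith
    have hbw : b - w = (-θ) • (y - b) := by rw [hw]; module
    have hyw : y - w = (1 - θ) • (y - b) := by rw [hw]; module
    have h2 := eval_ge_of_le_hessForm (p := p) (x := w) (y := b) (κ := 0) fun _ _ => hpsd _ _
    have h3 := eval_ge_of_le_hessForm (p := p) (x := w) (y := y) (κ := 0) fun _ _ => hpsd _ _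
    rw [hbw, gradForm_smul] at h2
    rw [hyw, gradForm_smul] at h3
    have hpos : 0 < gradForm p w (y - b) := by
      by_contra hneg
      have := mul_nonneg hθ0.le (neg_nonneg.2 (not_lt.1 hneg))
      linarith
    have := mul_pos (sub_pos.2 hθ1) hpos
    linarith
  obtain ⟨z, hz, hzmin⟩ := (isCompact_closedBall b ρ).exists_isMinOn ⟨b, hb⟩
    (continuous_eval_euclidean p).continuousOn
  have hmem : ∀ z', IsMinimizer p z' → z' ∈ Metric.closedBall b ρ := fun z' hz' => by
    by_contra h
    exact absurd (hz' b) (not_le.2 (hout z' h))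
  have hzM : IsMinimizer p z := by
    intro y
    by_cases hy : y ∈ Metric.closedBall b ρ
    · exact hzmin hy
    · exact (hzmin hb).trans (hout y hy).le
  refine ⟨z, hzM, fun z' hz' => ?_, ?_⟩
  · by_contra hne
    have hz'b := hmem z' hz'
    -- In the strong convexity inequalities from w to z and to z' the gradient terms cancel, giving
    -- p(z) + p(z') > 2p(w).
    set w := midpoint ℝ z z' with hw
    have hwb : w ∈ Metric.closedBall b ρ :=
      (convex_closedBall b ρ).segment_subset hz hz'b (midpoint_mem_segment z z')
    have h1 := hstrong w hwb z hz
    have h2 := hstrong w hwb z' hz'b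
    have e : z - w = (-1 : ℝ) • (z' - w) := by
      rw [hw, midpoint_eq_smul_add, invOf_eq_inv]; module
    have hn : 0 < ‖z' - w‖ := by
      have : z' - w = (1 / 2 : ℝ) • (z' - z) := by
        rw [hw, midpoint_eq_smul_add, invOf_eq_inv]; module
      rw [this, norm_smul]
      exact mul_pos (by norm_num) (norm_pos_iff.2 (sub_ne_zero.2 hne))
    have hn2 : 0 < μ * ‖z' - w‖ ^ 2 := by positivity
    rw [e, gradForm_smul, norm_smul, norm_neg, norm_one, one_mul] at h1
    have h3 := hz' w
    have h4 := hzM w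
    change eval z p ≤ eval w p at h4
    change eval z' p ≤ eval w p at h3
    linarith
  · have h1 := hfromb z hz
    have h2 : eval z p ≤ eval b p := hzM b
    have h3 : 0 ≤ ‖z - b‖ := norm_nonneg _
    rcases h3.eq_or_lt with h0 | h0
    · rw [← h0]
      linarith
    · by_contra hcon
      nlinarith

end Lines

/-! ### Taylor remainders and the gradient of the Taylor polynomial -/

section Taylor

/-- A one-dimensional Taylor estimate: a bound for the oscillation of the top derivative bounds
the remainder. -/
theorem abs_sub_taylor_le {d : ℕ} {φ : ℕ → ℝ → ℝ} {M : ℝ}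
    (hφ : ∀ k < d, ∀ s, HasDerivAt (φ k) (φ (k + 1) s) s)
    (hM : ∀ s ∈ Set.Icc (0 : ℝ) 1, |φ d s - φ d 0| ≤ M) {s : ℝ} (hs : s ∈ Set.Icc (0 : ℝ) 1) :
    |φ 0 s - ∑ i ∈ Finset.range (d + 1), φ i 0 / (i.factorial : ℝ) * s ^ i| ≤ M := by
  have hM0 : 0 ≤ M := (abs_nonneg _).trans (hM 0 (by simp))
  induction d generalizing φ s with
  | zero => simpa using hM s hs
  | succ d ih =>
    have ih' := fun s (hs : s ∈ Set.Icc (0 : ℝ) 1) => ih (φ := fun k => φ (k + 1))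
      (fun k hk s => hφ (k + 1) (by omega) s) hM hs
    have hder : ∀ s, HasDerivAt
        (fun s => φ 0 s - ∑ i ∈ Finset.range (d + 1 + 1), φ i 0 / (i.factorial : ℝ) * s ^ i)
        (φ 1 s - ∑ i ∈ Finset.range (d + 1), φ (i + 1) 0 / (i.factorial : ℝ) * s ^ i) s := by
      intro s
      refine (hφ 0 (by omega) s).sub ?_
      have h1 : HasDerivAt
          (fun s => ∑ i ∈ Finset.range (d + 1 + 1), φ i 0 / (i.factorial : ℝ) * s ^ i)
          (∑ i ∈ Finset.range (d + 1 + 1),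
            φ i 0 / (i.factorial : ℝ) * ((i : ℝ) * s ^ (i - 1))) s :=
        HasDerivAt.fun_sum fun i _ => (hasDerivAt_pow i s).const_mul _
      rw [Finset.sum_range_succ'] at h1
      simp only [Nat.cast_zero, zero_mul, mul_zero, add_zero] at h1
      refine h1.congr_deriv (Finset.sum_congr rfl fun i _ => ?_)
      rw [Nat.factorial_succ, Nat.add_sub_cancel]
      have : (i.factorial : ℝ) ≠ 0 := by positivity
      push_cast
      field_simp
    -- The mean value inequality is applied to r ↦ r s on [0, 1], with the induction hypothesis for
    -- the shifted family bounding the derivative.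
    have h := norm_image_sub_le_of_norm_deriv_le_segment_01'
      (f := fun r => φ 0 (r * s) - ∑ i ∈ Finset.range (d + 1 + 1),
        φ i 0 / (i.factorial : ℝ) * (r * s) ^ i)
      (f' := fun r => (φ 1 (r * s) - ∑ i ∈ Finset.range (d + 1),
        φ (i + 1) 0 / (i.factorial : ℝ) * (r * s) ^ i) * s) (C := M)
      (fun r _ => by
        have := (hder (r * s)).comp r ((hasDerivAt_id r).mul_const s)
        rw [one_mul] at this
        exact this.hasDerivWithinAt)
      (fun r hr => by
        have hrs : r * s ∈ Set.Icc (0 : ℝ) 1 :=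
          ⟨mul_nonneg hr.1 hs.1, mul_le_one₀ hr.2.le hs.1 hs.2⟩
        rw [Real.norm_eq_abs, abs_mul, abs_of_nonneg hs.1]
        exact (mul_le_of_le_one_right (abs_nonneg _) hs.2).trans (ih' _ hrs))
    simp only [one_mul, zero_mul] at h
    rw [Finset.sum_range_succ' (fun i => φ i 0 / (i.factorial : ℝ) * (0 : ℝ) ^ i)] at h
    simpa using h

variable {n : ℕ}

theorem multilinear_eq_sum {i : ℕ}
    (A : ContinuousMultilinearMap ℝ (fun _ : Fin i => EuclideanSpace ℝ (Fin n)) ℝ)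
    (m : Fin i → EuclideanSpace ℝ (Fin n)) :
    A m = ∑ j : Fin i → Fin n, A (fun l => EuclideanSpace.single (j l) (1 : ℝ)) *
      ∏ l, m l (j l) := by
  have h : m = fun l => ∑ k : Fin n, m l k • EuclideanSpace.single k (1 : ℝ) := by
    ext l k
    simp [Finset.sum_apply, Pi.single_apply]
  conv_lhs => rw [h]
  rw [A.map_sum]
  refine Finset.sum_congr rfl fun j _ => ?_
  rw [A.map_smul_univ, smul_eq_mul, mul_comm]

theorem eval_taylorPoly (f : EuclideanSpace ℝ (Fin n) → ℝ) (d : ℕ)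
    (a x : EuclideanSpace ℝ (Fin n)) :
    eval x (taylorPoly f d a) = ∑ i ∈ Finset.range (d + 1),
      iteratedFDeriv ℝ i f a (fun _ => x - a) / (i.factorial : ℝ) := by
  simp only [taylorPoly, map_sum, map_mul, eval_C, map_prod, map_sub, eval_X]
  refine Finset.sum_congr rfl fun i _ => ?_
  rw [multilinear_eq_sum, one_div, div_eq_inv_mul]
  rfl

theorem hasDerivAt_iteratedFDeriv_line {f : EuclideanSpace ℝ (Fin n) → ℝ} {k : ℕ}
    (hf : Differentiable ℝ (iteratedFDeriv ℝ k f)) (a w : EuclideanSpace ℝ (Fin n)) (s : ℝ) :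
    HasDerivAt (fun s : ℝ => iteratedFDeriv ℝ k f (a + s • w) (fun _ => w))
      (iteratedFDeriv ℝ (k + 1) f (a + s • w) (fun _ => w)) s := by
  have h1 : HasDerivAt (fun s : ℝ => a + s • w) w s := by
    simpa using ((hasDerivAt_id s).smul_const w).const_add a
  have h2 := (hf (a + s • w)).hasFDerivAt.comp_hasDerivAt s h1
  have h3 := (ContinuousMultilinearMap.apply ℝ
    (fun _ : Fin k => EuclideanSpace ℝ (Fin n)) ℝ (fun _ => w)).hasFDerivAt.comp_hasDerivAt s h2
  exact h3

/-- Multivariate Taylor estimate on a ball on which the top derivative is Lipschitz. -/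
theorem abs_sub_eval_taylorPoly_le {f : EuclideanSpace ℝ (Fin n) → ℝ} {d : ℕ}
    (hf : HasDerivativesUpTo d f) {b : EuclideanSpace ℝ (Fin n)} {rL L : ℝ} (hL : 0 ≤ L)
    (hLip : ∀ x ∈ Metric.closedBall b rL, ∀ y ∈ Metric.closedBall b rL,
      ‖iteratedFDeriv ℝ d f x - iteratedFDeriv ℝ d f y‖ ≤ L * ‖x - y‖)
    {a x : EuclideanSpace ℝ (Fin n)} (ha : a ∈ Metric.closedBall b rL)
    (hx : x ∈ Metric.closedBall b rL) :
    |f x - eval x (taylorPoly f d a)| ≤ L * ‖x - a‖ ^ (d + 1) := by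
  have h := abs_sub_taylor_le (d := d) (M := L * ‖x - a‖ ^ (d + 1))
    (φ := fun k s => iteratedFDeriv ℝ k f (a + s • (x - a)) (fun _ => x - a))
    (fun k hk s => hasDerivAt_iteratedFDeriv_line (hf k hk) a (x - a) s)
    (fun s hs => by
      have hmem : a + s • (x - a) ∈ Metric.closedBall b rL :=
        (convex_closedBall b rL).add_smul_sub_mem ha hx hs
      have h1 := hLip _ hmem a ha
      have h2 : ‖a + s • (x - a) - a‖ ≤ ‖x - a‖ := by
        rw [add_sub_cancel_left, norm_smul, Real.norm_of_nonneg hs.1]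
        exact mul_le_of_le_one_left (norm_nonneg _) hs.2
      have h3 := (iteratedFDeriv ℝ d f (a + s • (x - a)) - iteratedFDeriv ℝ d f a).le_opNorm
        (fun _ => x - a)
      rw [zero_smul, add_zero, ← sub_apply, ← Real.norm_eq_abs]
      refine h3.trans ?_
      rw [Finset.prod_const, Finset.card_univ, Fintype.card_fin, pow_succ', ← mul_assoc]
      exact mul_le_mul_of_nonneg_right (h1.trans (mul_le_mul_of_nonneg_left h2 hL))
        (pow_nonneg (norm_nonneg _) _))
    (s := 1) (by simp)
  rw [eval_taylorPoly]
  simpa using h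

theorem natDegree_onLine_taylorPoly_le (f : EuclideanSpace ℝ (Fin n) → ℝ) (d : ℕ)
    (a x v : EuclideanSpace ℝ (Fin n)) :
    (onLine x v (rename Sum.inl (taylorPoly f d a))).natDegree ≤ d := by
  simp only [taylorPoly, map_sum, map_mul, map_prod, map_sub, rename_C, rename_X]
  refine Polynomial.natDegree_sum_le_of_forall_le _ _ fun i hi => ?_
  have hi' : i ≤ d := by simpa [Nat.lt_succ_iff] using hi
  have hC : ∀ c : ℝ, onLine x v (C c) = Polynomial.C c := fun c => by simp [onLine]
  rw [hC]
  refine (Polynomial.natDegree_C_mul_le _ _).trans ?_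
  refine Polynomial.natDegree_sum_le_of_forall_le _ _ fun j _ => ?_
  rw [hC]
  refine (Polynomial.natDegree_C_mul_le _ _).trans ((Polynomial.natDegree_prod_le _ _).trans ?_)
  refine (Finset.sum_le_card_nsmul _ _ 1 fun l _ => ?_).trans (by simpa using hi')
  rw [hC]
  simp only [onLine, aeval_X, Sum.elim_inl]
  compute_degree

/-- The derivative at `0` of a polynomial of bounded degree is controlled by its size on the unit
interval. -/
theorem exists_abs_derivative_le (d : ℕ) : ∃ κ : ℝ, 0 ≤ κ ∧ ∀ (P : Polynomial ℝ) (M : ℝ),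
    P.natDegree ≤ d → (∀ s ∈ Set.Icc (0 : ℝ) 1, |P.eval s| ≤ M) →
      |P.derivative.eval 0| ≤ κ * M := by
  -- These d + 1 nodes in [0, 1] determine P by Lagrange interpolation, so κ is the sum of |ℓₖ'(0)|
  -- over the basis polynomials ℓₖ.
  set v : ℕ → ℝ := fun k => k / (d + 1) with hv
  have hinj : Set.InjOn v (Finset.range (d + 1)) := fun k _ l _ h => by
    have : (k : ℝ) = l := by
      simp only [hv] at h
      field_simp at h
      exact h
    exact_mod_cast this
  refine ⟨∑ k ∈ Finset.range (d + 1),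
    |(Lagrange.basis (Finset.range (d + 1)) v k).derivative.eval 0|,
    Finset.sum_nonneg fun _ _ => abs_nonneg _, fun P M hP hM => ?_⟩
  have hdeg : P.degree < (Finset.range (d + 1)).card := by
    rw [Finset.card_range]
    exact (Polynomial.degree_le_of_natDegree_le hP).trans_lt (by exact_mod_cast Nat.lt_succ_self d)
  have hint := Lagrange.eq_interpolate hinj hdeg
  rw [hint, Lagrange.interpolate_apply, Polynomial.derivative_sum, Polynomial.eval_finsetSum,
    Finset.sum_mul]
  refine (Finset.abs_sum_le_sum_abs _ _).trans (Finset.sum_le_sum fun k hk => ?_)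
  rw [Polynomial.derivative_C_mul, Polynomial.eval_C_mul, abs_mul, mul_comm]
  refine mul_le_mul_of_nonneg_left (hM _ ⟨by positivity, ?_⟩) (abs_nonneg _)
  rw [hv, div_le_one (by positivity)]
  have := Finset.mem_range.1 hk
  exact_mod_cast this.le

theorem gradForm_taylorPoly_self {f : EuclideanSpace ℝ (Fin n) → ℝ} {d : ℕ} (hd : 1 ≤ d)
    (b v : EuclideanSpace ℝ (Fin n)) : gradForm (taylorPoly f d b) b v = fderiv ℝ f b v := by
  have h : onLine b v (rename Sum.inl (taylorPoly f d b)) = ∑ i ∈ Finset.range (d + 1),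
      Polynomial.C (iteratedFDeriv ℝ i f b (fun _ => v) / (i.factorial : ℝ)) *
        Polynomial.X ^ i := by
    refine Polynomial.funext fun s => ?_
    rw [eval_onLine_rename, eval_taylorPoly, Polynomial.eval_finsetSum]
    refine Finset.sum_congr rfl fun i _ => ?_
    rw [add_sub_cancel_left, ContinuousMultilinearMap.map_smul_univ]
    simp
    ring
  rw [← derivative_onLine_eval_zero, h, ← Polynomial.coeff_zero_eq_eval_zero,
    Polynomial.coeff_derivative, Polynomial.finsetSum_coeff]
  simp only [Polynomial.coeff_C_mul, Polynomial.coeff_X_pow]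
  rw [Finset.sum_eq_single 1]
  · simp
  · intro i _ hi
    simp [hi.symm]
  · intro h1
    exact absurd (Finset.mem_range.2 (by omega)) h1

/-- The expansions at a and at b both approximate f up to O(δ^(d+1)) on the δ-ball about b, δ = ‖a -
b‖. Their difference has degree at most d on lines, so its derivative at b along vectors of length δ
is O(δ^(d+1)) too, while the expansion at b has zero gradient there. -/
theorem exists_abs_gradForm_taylorPoly_le {f : EuclideanSpace ℝ (Fin n) → ℝ} {d : ℕ} (hd : 1 ≤ d)
    (hf : HasDerivativesUpTo d f) {b : EuclideanSpace ℝ (Fin n)} (hb : fderiv ℝ f b = 0)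
    {rL L : ℝ} (hL : 0 ≤ L)
    (hLip : ∀ x ∈ Metric.closedBall b rL, ∀ y ∈ Metric.closedBall b rL,
      ‖iteratedFDeriv ℝ d f x - iteratedFDeriv ℝ d f y‖ ≤ L * ‖x - y‖) :
    ∃ c : ℝ, 0 ≤ c ∧ ∀ a ∈ Metric.closedBall b rL, ∀ v,
      |gradForm (taylorPoly f d a) b v| ≤ c * ‖a - b‖ ^ d * ‖v‖ := by
  obtain ⟨κ, hκ, hder⟩ := exists_abs_derivative_le d
  -- Points of the δ-ball about b lie within 2δ of a and δ of b, whence the two summands.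
  refine ⟨κ * (L * 2 ^ (d + 1) + L), by positivity, fun a ha v => ?_⟩
  set δ := ‖a - b‖ with hδ
  have hδ0 : 0 ≤ δ := norm_nonneg _
  have hδr : δ ≤ rL := by rwa [← mem_closedBall_iff_norm]
  have hbL : b ∈ Metric.closedBall b rL := Metric.mem_closedBall_self (hδ0.trans hδr)
  have key : ∀ w : EuclideanSpace ℝ (Fin n), ‖w‖ ≤ δ →
      |gradForm (taylorPoly f d a) b w| ≤ κ * ((L * 2 ^ (d + 1) + L) * δ ^ (d + 1)) := by
    intro w hw
    have h := hder (onLine b w (rename Sum.inl (taylorPoly f d a)) -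
      onLine b w (rename Sum.inl (taylorPoly f d b))) ((L * 2 ^ (d + 1) + L) * δ ^ (d + 1))
      ((Polynomial.natDegree_sub_le _ _).trans (max_le
        (natDegree_onLine_taylorPoly_le f d a b w) (natDegree_onLine_taylorPoly_le f d b b w)))
      (fun s hs => by
        rw [Polynomial.eval_sub, eval_onLine_rename, eval_onLine_rename]
        have hsw : ‖s • w‖ ≤ δ := by
          rw [norm_smul, Real.norm_of_nonneg hs.1]
          exact (mul_le_of_le_one_left (norm_nonneg _) hs.2).trans hw
        have hx : b + s • w ∈ Metric.closedBall b rL := by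
          rw [mem_closedBall_iff_norm, add_sub_cancel_left]
          exact hsw.trans hδr
        have h1 := abs_sub_eval_taylorPoly_le hf hL hLip ha hx
        have h2 := abs_sub_eval_taylorPoly_le hf hL hLip hbL hx
        rw [add_sub_cancel_left] at h2
        have h3 : ‖b + s • w - a‖ ≤ 2 * δ := by
          have : b + s • w - a = s • w - (a - b) := by abel
          rw [this]
          exact (norm_sub_le _ _).trans (by linarith)
        have h4 : ‖b + s • w - a‖ ^ (d + 1) ≤ 2 ^ (d + 1) * δ ^ (d + 1) := by
          rw [← mul_pow]; exact pow_le_pow_left₀ (norm_nonneg _) h3 _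
        have h5 := mul_le_mul_of_nonneg_left h4 hL
        have h6 := mul_le_mul_of_nonneg_left (pow_le_pow_left₀ (norm_nonneg _) hsw (d + 1)) hL
        rw [abs_sub_comm] at h1
        calc |_| ≤ _ := abs_sub_le _ (f (b + s • w)) _
          _ ≤ _ := by linarith)
    rwa [Polynomial.derivative_sub, Polynomial.eval_sub, derivative_onLine_eval_zero,
      derivative_onLine_eval_zero, gradForm_taylorPoly_self hd, hb, zero_apply,
      sub_zero] at h
  rcases hδ0.eq_or_lt with h0 | h0
  · have hab : a = b := by rw [← sub_eq_zero, ← norm_eq_zero]; exact h0.symm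
    rw [hab, gradForm_taylorPoly_self hd, hb, zero_apply, abs_zero]
    positivity
  · rcases (norm_nonneg v).eq_or_lt with hv | hv
    · have hv0 : v = (0 : ℝ) • v := by rw [zero_smul]; exact norm_eq_zero.1 hv.symm
      rw [hv0, gradForm_smul, zero_mul, abs_zero]
      positivity
    -- Rescaling v to length δ and dividing by δ lowers the exponent from d + 1 to d.
    · have h := key ((δ / ‖v‖) • v) (by
        rw [norm_smul, Real.norm_of_nonneg (by positivity), div_mul_cancel₀ _ hv.ne'])
      rw [gradForm_smul, abs_mul, abs_of_nonneg (by positivity), div_mul_eq_mul_div,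
        div_le_iff₀ hv, pow_succ] at h
      refine le_of_mul_le_mul_left (h.trans_eq ?_) h0
      ring

end Taylor

/-! ### Uniform bounds on the Taylor coefficients near the minimizer -/

section LocalBounds

variable {n : ℕ}

theorem sum_fin_two_arrow {ι M : Type*} [Fintype ι] [AddCommMonoid M] (F : (Fin 2 → ι) → M) :
    ∑ j, F j = ∑ i, ∑ i', F ![i, i'] := by
  rw [← (finTwoArrowEquiv ι).symm.sum_comp, Fintype.sum_prod_type]
  rfl

theorem hessForm_prod_fin_two (a : EuclideanSpace ℝ (Fin n)) (i i' : Fin n) :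
    hessForm (∏ l : Fin 2, (X (![i, i'] l) - C (a (![i, i'] l)))) =
      (2 : ℝ) • (X (Sum.inr i) * X (Sum.inr i')) := by
  have h0 : (Finset.univ : Finset (Fin 2)).erase 0 = {1} := by decide
  have h1 : (Finset.univ : Finset (Fin 2)).erase 1 = {0} := by decide
  rw [hessForm_prod, Fin.sum_univ_two, h0, h1, Finset.sum_singleton, Finset.sum_singleton,
    Finset.erase_singleton, Finset.erase_singleton, two_smul]
  simp [mul_comm]

theorem hessForm_taylorPoly_eq_add {f : EuclideanSpace ℝ (Fin n) → ℝ} {d : ℕ} (hd : 2 ≤ d)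
    (a : EuclideanSpace ℝ (Fin n)) :
    hessForm (taylorPoly f d a) =
      ∑ i, ∑ i', hessian f a i i' • (X (Sum.inr i) * X (Sum.inr i')) +
      ∑ i ∈ Finset.Ico 3 (d + 1), ∑ j : Fin i → Fin n, (1 / (i.factorial : ℝ) * partials f a i j) •
        hessForm (∏ l : Fin i, (X (j l) - C (a (j l)))) := by
  rw [hessForm_taylorPoly, Finset.range_eq_Ico,
    ← Finset.sum_Ico_consecutive _ (Nat.zero_le 3) (by omega : 3 ≤ d + 1)]
  congr 1
  rw [← Finset.range_eq_Ico, Finset.sum_range_succ, Finset.sum_range_succ, Finset.sum_range_one]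
  have h0 : ∀ j : Fin 0 → Fin n, hessForm (∏ l : Fin 0, (X (j l) - C (a (j l)))) = 0 := by
    intro j; rw [hessForm_prod]; simp
  have h1 : ∀ j : Fin 1 → Fin n, hessForm (∏ l : Fin 1, (X (j l) - C (a (j l)))) = 0 := by
    intro j; rw [hessForm_prod]; simp
  simp only [h0, h1, smul_zero, Finset.sum_const_zero, zero_add]
  rw [sum_fin_two_arrow]
  refine Finset.sum_congr rfl fun i _ => Finset.sum_congr rfl fun i' _ => ?_
  rw [hessForm_prod_fin_two, smul_smul, hessian, Matrix.of_apply]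
  congr 1
  simp
  ring

theorem dotProduct_hessian_mulVec (f : EuclideanSpace ℝ (Fin n) → ℝ)
    (a : EuclideanSpace ℝ (Fin n)) (x : Fin n → ℝ) :
    star x ⬝ᵥ ((hessian f a).mulVec x) = iteratedFDeriv ℝ 2 f a (fun _ => WithLp.toLp 2 x) := by
  rw [multilinear_eq_sum, sum_fin_two_arrow]
  simp only [dotProduct, Matrix.mulVec, Finset.mul_sum, star_trivial]
  refine Finset.sum_congr rfl fun i _ => Finset.sum_congr rfl fun i' _ => ?_
  rw [hessian, Matrix.of_apply, partials]
  simp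
  ring

theorem isHermitian_hessian {f : EuclideanSpace ℝ (Fin n) → ℝ} {d : ℕ} (hd : 3 ≤ d)
    (hf : HasDerivativesUpTo d f) (a : EuclideanSpace ℝ (Fin n)) : (hessian f a).IsHermitian := by
  have hC : ContDiff ℝ 2 f :=
    contDiff_of_differentiable_iteratedFDeriv (n := 2) fun m hm => hf m (by
      have : m ≤ 2 := by exact_mod_cast hm
      omega)
  have hsymm : IsSymmSndFDerivAt ℝ f a := hC.contDiffAt.isSymmSndFDerivAt (by simp)
  ext i i'
  simp only [Matrix.conjTranspose_apply, hessian, Matrix.of_apply, partials, star_trivial]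
  rw [iteratedFDeriv_two_apply, iteratedFDeriv_two_apply]
  simpa using hsymm _ _

theorem toLp_norm_sq (x : Fin n → ℝ) : ‖WithLp.toLp 2 x‖ ^ 2 = star x ⬝ᵥ x := by
  rw [EuclideanSpace.real_norm_sq_eq]
  simp [dotProduct, sq]

/-- Near a point with positive definite Hessian, the Hessians are uniformly positive definite. -/
theorem eventually_hessian_posDef {f : EuclideanSpace ℝ (Fin n) → ℝ} {d : ℕ} (hd : 3 ≤ d)
    (hf : HasDerivativesUpTo d f) {b : EuclideanSpace ℝ (Fin n)} (hpos : (hessian f b).PosDef) :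
    ∃ m : ℝ, 0 < m ∧ ∀ᶠ a in nhds b, (hessian f a).PosDef ∧
      (hessian f a - m • (1 : Matrix (Fin n) (Fin n) ℝ)).PosSemidef := by
  have hcont : Continuous fun v : EuclideanSpace ℝ (Fin n) =>
      iteratedFDeriv ℝ 2 f b (fun _ => v) :=
    (iteratedFDeriv ℝ 2 f b).cont.comp (continuous_pi fun _ => continuous_id)
  -- This form of the compactness argument also covers n = 0, where the sphere is empty.
  obtain ⟨m, hm, hmle⟩ := (isCompact_sphere (0 : EuclideanSpace ℝ (Fin n)) 1).exists_forall_le'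
    hcont.continuousOn (a := 0) (fun v hv => by
      have hv0 : v.ofLp ≠ 0 := by
        intro h
        have : v = 0 := by ext i; exact congrFun h i
        simp [this] at hv
      have := hpos.dotProduct_mulVec_pos hv0
      rwa [dotProduct_hessian_mulVec] at this)
  have hb : ∀ v : EuclideanSpace ℝ (Fin n), m * ‖v‖ ^ 2 ≤ iteratedFDeriv ℝ 2 f b (fun _ => v) := by
    intro v
    rcases (norm_nonneg v).eq_or_lt with h0 | h0
    · have hv0 : v = 0 := norm_eq_zero.1 h0.symm
      subst hv0
      have : iteratedFDeriv ℝ 2 f b (fun _ => (0 : EuclideanSpace ℝ (Fin n))) = 0 :=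
        (iteratedFDeriv ℝ 2 f b).map_zero
      rw [this]; simp
    · have h1 := hmle (‖v‖⁻¹ • v) (by
        rw [mem_sphere_zero_iff_norm, norm_smul, norm_inv, norm_norm, inv_mul_cancel₀ h0.ne'])
      rw [ContinuousMultilinearMap.map_smul_univ] at h1
      simp only [Finset.prod_const, Finset.card_univ, Fintype.card_fin, smul_eq_mul] at h1
      rw [inv_pow, inv_mul_eq_div, le_div_iff₀ (by positivity)] at h1
      exact h1
  refine ⟨m / 2, half_pos hm, ?_⟩
  have hD : ∀ᶠ a in nhds b, dist (iteratedFDeriv ℝ 2 f a) (iteratedFDeriv ℝ 2 f b) < m / 2 :=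
    (Metric.continuousAt_iff'.1 (hf 2 (by omega)).continuous.continuousAt) _ (half_pos hm)
  filter_upwards [hD] with a ha
  have hle : ∀ v : EuclideanSpace ℝ (Fin n),
      m / 2 * ‖v‖ ^ 2 ≤ iteratedFDeriv ℝ 2 f a (fun _ => v) := by
    intro v
    have h1 := (iteratedFDeriv ℝ 2 f a - iteratedFDeriv ℝ 2 f b).le_opNorm (fun _ => v)
    rw [sub_apply, Real.norm_eq_abs, Finset.prod_const, Finset.card_univ, Fintype.card_fin,
      ← dist_eq_norm] at h1
    have h2 := (abs_le.1 h1).1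
    have h3 := hb v
    have h4 := mul_le_mul_of_nonneg_right ha.le (sq_nonneg ‖v‖)
    linarith
  have hH := isHermitian_hessian hd hf a
  refine ⟨.of_dotProduct_mulVec_pos hH fun x hx => ?_, .of_dotProduct_mulVec_nonneg ?_ fun x => ?_⟩
  · rw [dotProduct_hessian_mulVec]
    refine lt_of_lt_of_le ?_ (hle _)
    have : 0 < ‖WithLp.toLp 2 x‖ := norm_pos_iff.2 (by simpa using hx)
    positivity
  · exact hH.sub (by
      rw [Matrix.IsHermitian, Matrix.conjTranspose_smul, Matrix.conjTranspose_one, star_trivial])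
  · rw [Matrix.sub_mulVec, dotProduct_sub, dotProduct_hessian_mulVec, Matrix.smul_mulVec,
      Matrix.one_mulVec, dotProduct_smul, ← toLp_norm_sq, smul_eq_mul, sub_nonneg]
    exact hle _

theorem eventually_partials_le {f : EuclideanSpace ℝ (Fin n) → ℝ} {d : ℕ}
    {b : EuclideanSpace ℝ (Fin n)} (hf : ∀ i ≤ d, ContinuousAt (iteratedFDeriv ℝ i f) b) :
    ∃ M : ℝ, ∀ᶠ a in nhds b, ∀ i ≤ d, ∀ j, |1 / (i.factorial : ℝ) * partials f a i j| ≤ M := by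
  refine ⟨∑ i ∈ Finset.range (d + 1), (‖iteratedFDeriv ℝ i f b‖ + 1), ?_⟩
  have h : ∀ᶠ a in nhds b, ∀ i ∈ Finset.range (d + 1),
      ‖iteratedFDeriv ℝ i f a‖ < ‖iteratedFDeriv ℝ i f b‖ + 1 := by
    rw [Filter.eventually_all_finset]
    intro i hi
    exact (hf i (Nat.lt_succ_iff.1 (Finset.mem_range.1 hi))).norm.eventually_lt_const
      (lt_add_one _)
  filter_upwards [h] with a ha i hi j
  have hi' : i ∈ Finset.range (d + 1) := Finset.mem_range.2 (by omega)
  have h1 : |partials f a i j| ≤ ‖iteratedFDeriv ℝ i f a‖ := by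
    have := (iteratedFDeriv ℝ i f a).le_opNorm (fun l => EuclideanSpace.single (j l) (1 : ℝ))
    simpa [partials] using this
  have h2 : 1 / (i.factorial : ℝ) ≤ 1 := by
    rw [div_le_one (by positivity)]
    exact_mod_cast Nat.one_le_iff_ne_zero.2 i.factorial_ne_zero
  rw [abs_mul, abs_of_nonneg (by positivity)]
  refine (mul_le_of_le_one_left (abs_nonneg _) h2).trans (h1.trans ((ha i hi').le.trans ?_))
  exact Finset.single_le_sum (f := fun i => ‖iteratedFDeriv ℝ i f b‖ + 1)
    (fun _ _ => by positivity) hi'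

/-- Near a nondegenerate point, the Hessian form of the Taylor expansion is bounded from below,
in the order given by sums of squares. -/
theorem eventually_sosLE_hessForm {f : EuclideanSpace ℝ (Fin n) → ℝ} {d : ℕ} (hd : 3 ≤ d)
    (hf : HasDerivativesUpTo d f) {b : EuclideanSpace ℝ (Fin n)} (hpos : (hessian f b).PosDef)
    (hcont : ContinuousAt (iteratedFDeriv ℝ d f) b) :
    ∃ m : ℝ, 0 < m ∧ ∃ K : ℝ, 0 ≤ K ∧ ∀ᶠ a in nhds b, (hessian f a).PosDef ∧
      SosLE (m • dirSq n) (hessForm (taylorPoly f d a) + K • (shiftSq a ^ (d / 2) * dirSq n)) := by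
  obtain ⟨m, hm, hev⟩ := eventually_hessian_posDef hd hf hpos
  obtain ⟨M, hM⟩ := eventually_partials_le (f := f) (d := d) (b := b) fun i hi => by
    rcases hi.eq_or_lt with rfl | h
    · exact hcont
    · exact (hf i h).continuous.continuousAt
  -- Half of m pays for the terms of degree at least 3; the other half remains as the lower bound.
  obtain ⟨K, hK, hKs⟩ := exists_absorb_hessForm_tail n d (q := d / 2) (by omega) (half_pos hm) M
  refine ⟨m / 2, half_pos hm, K, hK, ?_⟩
  filter_upwards [hev, hM] with a ha hMa
  refine ⟨ha.1, ?_⟩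
  have h1 := hKs a (fun i j => 1 / (i.factorial : ℝ) * partials f a i j) hMa
  have h2 := isSumSq_of_posSemidef ha.2
    (fun i => (X (Sum.inr i) : MvPolynomial (Fin n ⊕ Fin n) ℝ))
  have h3 : ∑ i, ∑ i', (hessian f a - m • (1 : Matrix (Fin n) (Fin n) ℝ)) i i' •
      (X (Sum.inr i) * X (Sum.inr i') : MvPolynomial (Fin n ⊕ Fin n) ℝ) =
      ∑ i, ∑ i', hessian f a i i' • (X (Sum.inr i) * X (Sum.inr i')) - m • dirSq n := by
    simp only [Matrix.sub_apply, sub_smul, Finset.sum_sub_distrib, dirSq, Finset.smul_sum]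
    congr 1
    refine Finset.sum_congr rfl fun i _ => ?_
    rw [Finset.sum_eq_single i]
    · simp [sq]
    · intro i' _ hi'
      simp [Matrix.one_apply_ne hi'.symm]
    · simp
  rw [h3] at h2
  unfold SosLE
  rw [hessForm_taylorPoly_eq_add (by omega)]
  refine Eq.mp (congrArg IsSumSq ?_) (h1.add h2)
  have h4 : m • dirSq n = (m / 2) • dirSq n + (m / 2) • dirSq n := by rw [← add_smul, add_halves]
  rw [h4]
  abel

end LocalBounds

/-! ### One Newton step and its iteration -/

section Step

variable {n : ℕ}

theorem eval_dirSq (x v : EuclideanSpace ℝ (Fin n)) :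
    eval (Sum.elim x v) (dirSq n) = ‖v‖ ^ 2 := by
  rw [EuclideanSpace.real_norm_sq_eq]
  simp [dirSq]

theorem eval_shiftSq (a x v : EuclideanSpace ℝ (Fin n)) :
    eval (Sum.elim x v) (shiftSq a) = ‖x - a‖ ^ 2 := by
  rw [EuclideanSpace.real_norm_sq_eq]
  simp [shiftSq, shiftVar]

theorem SosLE.eval_le {P Q : MvPolynomial (Fin n ⊕ Fin n) ℝ} (h : SosLE P Q)
    (w : Fin n ⊕ Fin n → ℝ) : eval w P ≤ eval w Q := by
  have key : ∀ R : MvPolynomial (Fin n ⊕ Fin n) ℝ, IsSumSq R → IsSumSq (eval w R) := by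
    intro R hR
    induction hR with
    | zero => rw [map_zero]; exact .zero
    | sq_add a _ ih => rw [map_add, map_mul]; exact (IsSumSq.mul_self _).add ih
  have := (key _ h).nonneg
  rwa [map_sub, sub_nonneg] at this

/-- Drops the term with ⟨x - a, y⟩² and lowers the factor 2(q + 1) to 1. Through it, the regularizer
supplies the absorbing term ‖x - a‖^(2q)‖y‖². -/
theorem sosLE_hessForm_sqDistPoly_pow (a : EuclideanSpace ℝ (Fin n)) (q : ℕ) :
    SosLE (shiftSq a ^ q * dirSq n) (hessForm (sqDistPoly a ^ (q + 1))) := by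
  have hs : IsSumSq (shiftSq a) := IsSumSq.sum_sq _ _
  have hY : IsSumSq (dirSq n) := IsSumSq.sum_sq _ _
  rw [hessForm_sqDistPoly_pow, smul_add, smul_smul]
  have h1 : SosLE ((1 : ℝ) • (shiftSq a ^ q * dirSq n))
      ((((q + 1 : ℕ) : ℝ) * 2) • (shiftSq a ^ q * dirSq n)) :=
    sosLE_smul_of_le (by push_cast; linarith [(Nat.cast_nonneg q : (0 : ℝ) ≤ q)])
      ((isSumSq_pow hs q).mul hY)
  have h2 : SosLE 0 (((q + 1 : ℕ) : ℝ) • (q : ℝ) •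
      (shiftSq a ^ (q - 1) * (2 * ∑ i, shiftVar a i * X (Sum.inr i)) ^ 2)) := by
    unfold SosLE
    rw [sub_zero]
    exact isSumSq_smul (Nat.cast_nonneg _) (isSumSq_smul (Nat.cast_nonneg _)
      ((isSumSq_pow hs _).mul (isSumSq_sq _)))
  have := h1.add h2
  rwa [one_smul, add_zero] at this

theorem abs_gradForm_sqDistPoly_pow_le (a x v : EuclideanSpace ℝ (Fin n)) (q : ℕ) :
    |gradForm (sqDistPoly a ^ (q + 1)) x v| ≤ 2 * (q + 1) * ‖x - a‖ ^ (2 * q + 1) * ‖v‖ := by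
  have h : gradForm (sqDistPoly a ^ (q + 1)) x v =
      2 * (q + 1) * ‖x - a‖ ^ (2 * q) * inner ℝ v (x - a) := by
    rw [gradForm, map_pow, rename_sqDistPoly, Derivation.leibniz_pow, dirDeriv_shiftSq,
      Nat.add_sub_cancel, smul_eq_mul, nsmul_eq_mul, map_mul, map_mul, map_pow, eval_shiftSq,
      ← pow_mul, PiLp.inner_apply]
    simp [shiftVar]
    ring
  rw [h, abs_mul, abs_of_nonneg (by positivity), pow_succ]
  have := abs_real_inner_le_norm v (x - a)
  calc 2 * ((q : ℝ) + 1) * ‖x - a‖ ^ (2 * q) * |inner ℝ v (x - a)|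
      ≤ 2 * ((q : ℝ) + 1) * ‖x - a‖ ^ (2 * q) * (‖v‖ * ‖x - a‖) :=
        mul_le_mul_of_nonneg_left this (by positivity)
    _ = _ := by ring

theorem gradForm_C_mul (c : ℝ) (p : MvPolynomial (Fin n) ℝ) (x v : EuclideanSpace ℝ (Fin n)) :
    gradForm (C c * p) x v = c * gradForm p x v := by
  simp [gradForm, C_mul']

theorem surrogate_eq (f : EuclideanSpace ℝ (Fin n) → ℝ) (d : ℕ) (a : EuclideanSpace ℝ (Fin n))
    (t : ℝ) : surrogate f d a t = taylorPoly f d a + C t * sqDistPoly a ^ (d / 2 + 1) := by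
  have : evenAbove d / 2 = d / 2 + 1 := by unfold evenAbove; omega
  rw [surrogate, this]

theorem hessForm_surrogate (f : EuclideanSpace ℝ (Fin n) → ℝ) (d : ℕ)
    (a : EuclideanSpace ℝ (Fin n)) (t : ℝ) : hessForm (surrogate f d a t) =
      hessForm (taylorPoly f d a) + t • hessForm (sqDistPoly a ^ (d / 2 + 1)) := by
  rw [surrogate_eq, hessForm_add, hessForm_C_mul]

/-- The program that defines the regularization weight is feasible, with a bound for its value,
and the polynomial that belongs to the optimal value is convex. -/
theorem exists_isOptimalValue_surrogate {f : EuclideanSpace ℝ (Fin n) → ℝ} {d : ℕ}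
    {a : EuclideanSpace ℝ (Fin n)} {m K : ℝ} (hm : 0 ≤ m) (hK : 0 ≤ K)
    (h : SosLE (m • dirSq n)
      (hessForm (taylorPoly f d a) + K • (shiftSq a ^ (d / 2) * dirSq n))) :
    ∃ t, IsOptimalValue (surrogate f d a) t ∧ 0 ≤ t ∧ t ≤ K ∧
      ∀ x v : EuclideanSpace ℝ (Fin n),
        0 ≤ eval (Sum.elim x v) (hessForm (surrogate f d a t)) := by
  have hKmem : K ∈ {s : ℝ | 0 ≤ s ∧ SOSConvex (surrogate f d a s)} := by
    refine ⟨hK, ?_⟩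
    rw [sosConvex_iff, hessForm_surrogate]
    have h1 := h.trans ((SosLE.refl _).add ((sosLE_hessForm_sqDistPoly_pow a (d / 2)).smul hK))
    have hY : IsSumSq (dirSq n) := IsSumSq.sum_sq _ _
    have h2 := IsSumSq.add h1 (isSumSq_smul hm hY)
    rwa [sub_add_cancel] at h2
  have hbdd : BddBelow {s : ℝ | 0 ≤ s ∧ SOSConvex (surrogate f d a s)} := ⟨0, fun _ hs => hs.1⟩
  obtain ⟨t, ht⟩ := Real.exists_isGLB ⟨K, hKmem⟩ hbdd
  refine ⟨t, ht, ht.2 fun _ hs => hs.1, ht.1 hKmem, fun x v => ?_⟩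
  -- Pointwise nonnegativity is a closed condition on s, so it passes to the infimum. Convexity is
  -- all that is needed there; the sum-of-squares property is not.
  have hcl : IsClosed {s : ℝ | 0 ≤ eval (Sum.elim x v) (hessForm (surrogate f d a s))} := by
    refine isClosed_le continuous_const ?_
    simp only [hessForm_surrogate, map_add, smul_eval]
    fun_prop
  refine closure_minimal (fun s hs => ?_) hcl (ht.mem_closure ⟨K, hKmem⟩)
  have h1 : SosLE 0 (hessForm (surrogate f d a s)) := by
    unfold SosLE
    rw [sub_zero, ← sosConvex_iff]
    exact hs.2
  have := h1.eval_le (Sum.elim x v)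
  rwa [map_zero] at this

theorem exists_newtonStep {f : EuclideanSpace ℝ (Fin n) → ℝ} {d : ℕ} (hd : 3 ≤ d)
    {b : EuclideanSpace ℝ (Fin n)} (hf : HasDerivativesUpTo d f) (hmin : IsLocalMin f b)
    (hpos : (hessian f b).PosDef) {rL L : ℝ} (hrL : 0 < rL) (hL : 0 ≤ L)
    (hLip : ∀ x ∈ Metric.closedBall b rL, ∀ y ∈ Metric.closedBall b rL,
      ‖iteratedFDeriv ℝ d f x - iteratedFDeriv ℝ d f y‖ ≤ L * ‖x - y‖) :
    ∃ r : ℝ, 0 < r ∧ ∃ c : ℝ, 0 < c ∧ ∀ a, ‖a - b‖ ≤ r → ∃ z, ‖z - b‖ ≤ c * ‖a - b‖ ^ d ∧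
      ∀ ε z', NewtonStep f d ε a z' ↔ z' = z := by
  have hcont : ContinuousAt (iteratedFDeriv ℝ d f) b :=
    continuousAt_of_locally_lipschitz hrL L fun y hy => by
      rw [dist_eq_norm, dist_eq_norm]
      exact hLip y hy.le b (Metric.mem_closedBall_self hrL.le)
  obtain ⟨m, hm, K, hK, hev⟩ := eventually_sosLE_hessForm hd hf hpos hcont
  obtain ⟨r₀, hr₀, hr₀ev⟩ := Metric.eventually_nhds_iff_ball.1 hev
  obtain ⟨c₀, hc₀, hgrad⟩ := exists_abs_gradForm_taylorPoly_le (by omega) hf hmin.fderiv_eq_zero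
    hL hLip
  -- Gradient constants of the Taylor part and of the regularizer, the latter being K d'.
  obtain ⟨c₁, hc₁⟩ : ∃ c₁, c₁ = c₀ + K * (2 * ((d / 2 : ℕ) + 1)) := ⟨_, rfl⟩
  have hc₁0 : 0 ≤ c₁ := by rw [hc₁]; positivity
  -- If x and a are within ρ of b, then ‖x - a‖ ≤ 2ρ ≤ 1, so K‖x - a‖^(2q) ≤ 2Kρ ≤ m/2, which leaves
  -- strong convexity with modulus m/2.
  obtain ⟨ρ, hρ⟩ : ∃ ρ, ρ = min (1 / 2) (m / (4 * (K + 1))) := ⟨_, rfl⟩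
  have hρ0 : 0 < ρ := by rw [hρ]; positivity
  have hρ1 : ρ ≤ 1 / 2 := hρ ▸ min_le_left _ _
  have hρK : K * (2 * ρ) ≤ m / 2 := by
    have h1 : ρ ≤ m / (4 * (K + 1)) := hρ ▸ min_le_right _ _
    rw [le_div_iff₀ (by positivity)] at h1
    linarith
  -- The last bound ensures 2 c₁ δ^d < (m/2)ρ, the smallness condition of
  -- `exists_unique_isMinimizer`.
  obtain ⟨r, hr⟩ : ∃ r, r = min (min (r₀ / 2) rL) (min ρ (m * ρ / (8 * (c₁ + 1)))) := ⟨_, rfl⟩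
  have hr0 : 0 < r := by rw [hr]; positivity
  -- 4c₁/m is 2ζ/μ with ζ = c₁δ^d and μ = m/2, up to the factor δ^d; the added 1 makes the constant
  -- positive.
  refine ⟨r, hr0, 4 * c₁ / m + 1, by positivity, fun a ha => ?_⟩
  have har₀ : ‖a - b‖ < r₀ :=
    (ha.trans (hr ▸ (min_le_left _ _).trans (min_le_left _ _))).trans_lt (half_lt_self hr₀)
  have harL : ‖a - b‖ ≤ rL := ha.trans (hr ▸ (min_le_left _ _).trans (min_le_right _ _))
  have haρ : ‖a - b‖ ≤ ρ := ha.trans (hr ▸ (min_le_right _ _).trans (min_le_left _ _))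
  have hamρ : ‖a - b‖ ≤ m * ρ / (8 * (c₁ + 1)) :=
    ha.trans (hr ▸ (min_le_right _ _).trans (min_le_right _ _))
  set δ := ‖a - b‖ with hδ
  have hδ0 : 0 ≤ δ := norm_nonneg _
  have hδ1 : δ ≤ 1 := by linarith
  obtain ⟨hapos, hasos⟩ := hr₀ev a (by rwa [mem_ball_iff_norm])
  obtain ⟨t, ht, ht0, htK, hpsd⟩ := exists_isOptimalValue_surrogate hm.le hK hasos
  have hpd : ∀ x ∈ Metric.closedBall b ρ, ∀ v : EuclideanSpace ℝ (Fin n),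
      m / 2 * ‖v‖ ^ 2 ≤ eval (Sum.elim x v) (hessForm (surrogate f d a t)) := by
    intro x hx v
    rw [mem_closedBall_iff_norm] at hx
    have hxa : ‖x - a‖ ≤ 2 * ρ := by
      have : x - a = (x - b) - (a - b) := by abel
      rw [this]
      exact (norm_sub_le _ _).trans (by linarith)
    have h1 := hasos.eval_le (Sum.elim x v)
    have h2 := (sosLE_hessForm_sqDistPoly_pow a (d / 2)).eval_le (Sum.elim x v)
    rw [hessForm_surrogate]
    simp only [map_add, smul_eval, map_mul, map_pow, eval_dirSq, eval_shiftSq] at h1 h2 ⊢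
    have h3 : (‖x - a‖ ^ 2) ^ (d / 2) ≤ 2 * ρ := by
      rw [← pow_mul]
      exact (pow_le_of_le_one (norm_nonneg _) (by linarith) (by omega)).trans hxa
    have h4 : 0 ≤ t * eval (Sum.elim x v) (hessForm (sqDistPoly a ^ (d / 2 + 1))) :=
      mul_nonneg ht0 (le_trans (by positivity) h2)
    have h5 : K * ((‖x - a‖ ^ 2) ^ (d / 2) * ‖v‖ ^ 2) ≤ m / 2 * ‖v‖ ^ 2 := by
      rw [← mul_assoc]
      exact mul_le_mul_of_nonneg_right ((mul_le_mul_of_nonneg_left h3 hK).trans hρK) (sq_nonneg _)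
    linarith
  have hg : ∀ v, |gradForm (surrogate f d a t) b v| ≤ c₁ * δ ^ d * ‖v‖ := by
    intro v
    rw [surrogate_eq, gradForm_add, gradForm_C_mul]
    have h1 := hgrad a (by rwa [mem_closedBall_iff_norm]) v
    have h2 := abs_gradForm_sqDistPoly_pow_le a b v (d / 2)
    rw [norm_sub_rev b a] at h2
    -- Here d' > d enters, as d' - 1 = 2⌊d/2⌋ + 1 ≥ d.
    have h3 : ‖a - b‖ ^ (2 * (d / 2) + 1) ≤ δ ^ d := pow_le_pow_of_le_one hδ0 hδ1 (by omega)
    have h4 : |gradForm (sqDistPoly a ^ (d / 2 + 1)) b v| ≤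
        2 * ((d / 2 : ℕ) + 1) * δ ^ d * ‖v‖ :=
      h2.trans (mul_le_mul_of_nonneg_right (mul_le_mul_of_nonneg_left h3 (by positivity))
        (norm_nonneg _))
    have h5 : |t * gradForm (sqDistPoly a ^ (d / 2 + 1)) b v| ≤
        K * (2 * ((d / 2 : ℕ) + 1) * δ ^ d * ‖v‖) := by
      rw [abs_mul, abs_of_nonneg ht0]
      exact mul_le_mul htK h4 (abs_nonneg _) hK
    calc _ ≤ _ := abs_add_le _ _
      _ ≤ _ := add_le_add h1 h5
      _ = _ := by rw [hc₁]; ring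
  have hδd : δ ^ d ≤ δ := pow_le_of_le_one hδ0 hδ1 (by omega)
  have hsmall : 2 * (c₁ * δ ^ d) < m / 2 * ρ := by
    have h1 := mul_le_mul_of_nonneg_left hδd hc₁0
    rw [le_div_iff₀ (by positivity)] at hamρ
    have h2 : 0 < m * ρ := mul_pos hm hρ0
    nlinarith
  obtain ⟨z, hz, huniq, hzb⟩ := exists_unique_isMinimizer hρ0 (half_pos hm) (by positivity)
    hpsd hpd hg hsmall
  refine ⟨z, ?_, fun ε z' => ⟨?_, ?_⟩⟩
  · have h1 : ‖z - b‖ ≤ 4 * c₁ / m * δ ^ d := by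
      rw [div_mul_eq_mul_div, le_div_iff₀ hm]
      linarith
    have h2 : 0 ≤ δ ^ d := pow_nonneg hδ0 d
    linarith
  · rintro (⟨_, t', ht', hz'⟩ | ⟨hn, _⟩)
    · rw [ht'.unique ht] at hz'
      exact huniq z' hz'
    · exact absurd hapos hn
  · rintro rfl
    exact Or.inl ⟨hapos, t, ht, hz⟩

/-- If every point near `b` has exactly one successor, which is closer to `b` by a factor `1 / 2`
at least, then every starting point near `b` generates exactly one sequence, and it stays near
`b` and converges to `b`. -/
theorem exists_unique_iterates {E : Type*} [NormedAddCommGroup E] {S : E → E → Prop} {b : E} {r : ℝ}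
    {good : E → E → Prop} (h : ∀ a, ‖a - b‖ ≤ r → ∃ z, ‖z - b‖ ≤ 1 / 2 * ‖a - b‖ ∧ good a z ∧
      ∀ z', S a z' ↔ z' = z) {x₀ : E} (hx₀ : ‖x₀ - b‖ ≤ r) :
    (∃! x : ℕ → E, x 0 = x₀ ∧ ∀ k, S (x k) (x (k + 1))) ∧
      ∀ x : ℕ → E, (x 0 = x₀ ∧ ∀ k, S (x k) (x (k + 1))) →
        (∀ k, good (x k) (x (k + 1))) ∧ Filter.Tendsto x Filter.atTop (nhds b) := by
  choose! g hg1 hg2 hg3 using h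
  have hmap : ∀ a, ‖a - b‖ ≤ r → ‖g a - b‖ ≤ r := fun a ha =>
    (hg1 a ha).trans (by linarith [norm_nonneg (a - b)])
  have hgood : ∀ x : ℕ → E, (x 0 = x₀ ∧ ∀ k, S (x k) (x (k + 1))) →
      ∀ k, ‖x k - b‖ ≤ r ∧ x (k + 1) = g (x k) := by
    rintro x ⟨hx0, hx⟩ k
    have hstep : ∀ k, ‖x k - b‖ ≤ r → x (k + 1) = g (x k) := fun k hk =>
      (hg3 _ hk _).1 (hx k)
    have hmem : ∀ k, ‖x k - b‖ ≤ r := by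
      intro k
      induction k with
      | zero => rwa [hx0]
      | succ k ih => rw [hstep k ih]; exact hmap _ ih
    exact ⟨hmem k, hstep k (hmem k)⟩
  refine ⟨⟨fun k => g^[k] x₀, ⟨rfl, fun k => ?_⟩, fun x hx => ?_⟩, fun x hx => ⟨fun k => ?_, ?_⟩⟩
  · have hmem : ∀ k, ‖g^[k] x₀ - b‖ ≤ r := by
      intro k
      induction k with
      | zero => exact hx₀
      | succ k ih => rw [Function.iterate_succ_apply']; exact hmap _ ih
    exact (hg3 _ (hmem k) _).2 (Function.iterate_succ_apply' g k x₀)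
  · funext k
    induction k with
    | zero => exact hx.1
    | succ k ih => rw [(hgood x hx k).2, ih, Function.iterate_succ_apply']
  · rw [(hgood x hx k).2]
    exact hg2 _ (hgood x hx k).1
  · have hbound : ∀ k, ‖x k - b‖ ≤ (1 / 2) ^ k * r := by
      intro k
      induction k with
      | zero => rw [hx.1]; simpa using hx₀
      | succ k ih =>
        rw [(hgood x hx k).2, pow_succ']
        have := hg1 _ (hgood x hx k).1
        linarith
    rw [tendsto_iff_norm_sub_tendsto_zero]
    refine squeeze_zero (fun _ => norm_nonneg _) hbound ?_
    have := (tendsto_pow_atTop_nhds_zero_of_lt_one (by norm_num : (0 : ℝ) ≤ 1 / 2)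
      (by norm_num)).mul_const r
    rwa [zero_mul] at this

end Step

end SOSNewton

/-! ### Local convergence of order d -/

theorem mainTheorem1 {n d : ℕ} (hd : 3 ≤ d)
    (f : EuclideanSpace ℝ (Fin n) → ℝ) (xs : EuclideanSpace ℝ (Fin n))
    (hf : SOSNewton.HasDerivativesUpTo d f)
    (hmin : IsLocalMin f xs)
    (hpos : (SOSNewton.hessian f xs).PosDef)
    (hLip : ∃ rL : ℝ, 0 < rL ∧ ∃ L : ℝ, 0 ≤ L ∧
      ∀ x ∈ Metric.closedBall xs rL, ∀ y ∈ Metric.closedBall xs rL,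
        ‖iteratedFDeriv ℝ d f x - iteratedFDeriv ℝ d f y‖ ≤ L * ‖x - y‖) :
    ∃ r : ℝ, 0 < r ∧ ∃ c : ℝ, 0 < c ∧
      ∀ ε : ℝ, 0 < ε → ∀ x₀ : EuclideanSpace ℝ (Fin n), ‖x₀ - xs‖ ≤ r →
        (∃! x : ℕ → EuclideanSpace ℝ (Fin n), SOSNewton.GeneratedFrom f d ε x₀ x) ∧
        ∀ x : ℕ → EuclideanSpace ℝ (Fin n), SOSNewton.GeneratedFrom f d ε x₀ x →
          (∀ k, ‖x (k + 1) - xs‖ ≤ c * ‖x k - xs‖ ^ d) ∧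
          Filter.Tendsto x Filter.atTop (nhds xs) := by
  obtain ⟨rL, hrL, L, hL, hLip⟩ := hLip
  obtain ⟨r₀, hr₀, c, hc, hstep⟩ := SOSNewton.exists_newtonStep hd hf hmin hpos hrL hL hLip
  -- On this ball c‖a - x*‖^d ≤ c‖a - x*‖² ≤ ‖a - x*‖/2, the contraction that
  -- `exists_unique_iterates` requires.
  refine ⟨min r₀ (min 1 (1 / (2 * c))), by positivity, c, hc, fun ε _ x₀ hx₀ => ?_⟩
  refine SOSNewton.exists_unique_iterates (S := SOSNewton.NewtonStep f d ε)
    (good := fun a z => ‖z - xs‖ ≤ c * ‖a - xs‖ ^ d) (fun a ha => ?_) hx₀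
  obtain ⟨z, hz, huniq⟩ := hstep a (ha.trans (min_le_left _ _))
  refine ⟨z, hz.trans ?_, hz, huniq ε⟩
  have h1 : ‖a - xs‖ ≤ 1 := ha.trans ((min_le_right _ _).trans (min_le_left _ _))
  have h2 : ‖a - xs‖ ≤ 1 / (2 * c) := ha.trans ((min_le_right _ _).trans (min_le_right _ _))
  have h3 : ‖a - xs‖ ^ d ≤ ‖a - xs‖ ^ 2 :=
    pow_le_pow_of_le_one (norm_nonneg _) h1 (by omega)
  rw [le_div_iff₀ (by positivity)] at h2
  calc c * ‖a - xs‖ ^ d ≤ c * ‖a - xs‖ ^ 2 := mul_le_mul_of_nonneg_left h3 hc.le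
    _ = (‖a - xs‖ * c) * ‖a - xs‖ := by ring
    _ ≤ 1 / 2 * ‖a - xs‖ := mul_le_mul_of_nonneg_right (by linarith) (norm_nonneg _)
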